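/- All Hilbert spaces are finite-dimensional and complex. Let $\mathsf Q=\mathbb C^2$, $H=\frac1{\sqrt2}\begin{pmatrix}1&1\\1&-1\end{pmatrix}$, $X=\begin{pmatrix}0&1\\1&0\end{pmatrix}$, $Z=\begin{pmatrix}1&0\\0&-1\end{pmatrix}$, $|\beta\rangle=\cos\frac\pi8|0\rangle+\sin\frac\pi8|1\rangle$, and write $\|L\|_{\mathrm{Tr}}=\frac12\operatorname{Tr}\sqrt{L^\dagger L}$. In the game $\mathtt{TFKW}^n$ (the $n$-fold parallel repetition of the monogamy-of-entanglement game $\mathtt{TFKW}$), Alice holds $\mathsf Q^{\otimes n}$, draws $\theta\in\mathbb Z_2^n$ uniformly, announces it, and measures the POVM $A^\theta_x=\bigotimes_{i=1}^n H^{\theta_i}|x_i\rangle\langle x_i|H^{\theta_i}$, $x\in\mathbb Z_2^n$. A strategy $\mathtt S=(\mathsf B,\mathsf C,B,C,\rho)$ consists of Hilbert spaces $\mathsf B,\mathsf C$, for each $\theta$ POVMs $(B^\theta_x)_{x\in\mathbb Z_2^n}$ on $\mathsf B$ and $(C^\theta_x)_{x\in\mathbb Z_2^n}$ on $\mathsf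 C$, and a density operator $\rho$ on $\mathsf Q^{\otimes n}\otimes\mathsf B\otimes\mathsf C$. With $A^\theta_{y,i}=\sum_{x:\,x_i=y}A^\theta_x$, and $B^\theta_{y,i}$, $C^\theta_{y,i}$ defined likewise, its $i$-th winning probability is $$\mathfrak w^i_{\mathtt{TFKW}^n}(\mathtt S)=\frac1{2^n}\sum_{\theta\in\mathbb Z_2^n}\sum_{y\in\mathbb Z_2}\operatorname{Tr}\big[(A^\theta_{y,i}\otimes B^\theta_{y,i}\otimes C^\theta_{y,i})\rho\big].$$ **Corollary.** There is a universal constant $K\ge 0$ such that the following holds for every integer $n\ge1$, every strategy $\mathtt S=(\mathsf B,\mathsf C,B,C,\rho)$ for $\mathtt{TFKW}^n$ and every $\varepsilon\ge0$. If $\mathfrak w^i_{\mathtt{TFKW}^n}(\mathtt S)\ge\cos^2\frac\pi8-\varepsilon$ for each $i\in\{1,\dots,n\}$, then there are Hilbert spaces $\mathsf B',\mathsf C',\mathsf R$, isometries $V:\mathsf B\to\mathsf B'$ and $W:\mathsf C\to\mathsf C'$, and vectors $|\psi_t\rangle\in\mathsf B'\otimes\mathsf C'\otimes\mathsf R$ indexed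 by $t\in(\mathbb Z_2^2)^n$, $t=(t_{i0},t_{i1})_{i=1}^n$, which have pairwise orthogonal supports on $\mathsf B'$ and pairwise orthogonal supports on $\mathsf C'$ (that is, for $t\ne t'$ the ranges of the reduced operators on $\mathsf B'$ of $|\psi_t\rangle\langle\psi_t|$ and $|\psi_{t'}\rangle\langle\psi_{t'}|$ are orthogonal, and likewise on $\mathsf C'$), such that $$|\phi\rangle=\sum_{t\in(\mathbb Z_2^2)^n}X^{t_{10}}Z^{t_{11}}|\beta\rangle\otimes\cdots\otimes X^{t_{n0}}Z^{t_{n1}}|\beta\rangle\otimes|\psi_t\rangle$$ is a unit vector and $$\big\|(I\otimes V\otimes W)\,\rho\,(I\otimes V\otimes W)^\dagger-\operatorname{Tr}_{\mathsf R}|\phi\rangle\langle\phi|\big\|_{\mathrm{Tr}}\le K\,n^3\sqrt\varepsilon .$$ -/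

import Mathlib

open scoped Matrix Kronecker ComplexOrder

universe u

noncomputable section

/-! ### Finite-dimensional quantum information

A finite-dimensional Hilbert space is the space `H → ℂ` attached to a finite register `H`, operators
on it are matrices indexed by `H`, and the joint system of `H` and `K` has the register `H × K`. -/

/-- A density operator: positive semidefinite of trace one. -/
def IsDensityOperator {H : Type*} [Fintype H] (ρ : Matrix H H ℂ) : Prop :=
  ρ.PosSemidef ∧ ρ.trace = 1

/-- A positive operator-valued measurement on `H` with outcomes in `X`. -/
def IsPOVM {X H : Type*} [Fintype X] [DecidableEq H] (P : X → Matrix H H ℂ) : Prop :=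
  (∀ x, (P x).PosSemidef) ∧ ∑ x, P x = 1

/-- An isometry from the space of `H` to the space of `K`. -/
def IsIsometry {H K : Type*} [DecidableEq H] [Fintype K] (V : Matrix K H ℂ) : Prop :=
  Vᴴ * V = 1

/-- The operator `|v⟩⟨v|`. -/
def ketbra {H : Type*} (v : H → ℂ) : Matrix H H ℂ :=
  Matrix.vecMulVec v (star v)

/-- The partial trace over the second register. -/
def partialTraceRight {H K : Type*} [Fintype K] (M : Matrix (H × K) (H × K) ℂ) : Matrix H H ℂ :=
  Matrix.of fun h h' => ∑ k, M (h, k) (h', k)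

/-- The partial trace over the first register. -/
def partialTraceLeft {H K : Type*} [Fintype H] (M : Matrix (H × K) (H × K) ℂ) : Matrix K K ℂ :=
  Matrix.of fun k k' => ∑ h, M (h, k) (h, k')

/-- The trace norm with the normalisation `(1/2) Tr |L|`, where `|L| = √(L† L)`. -/
def traceNorm {H : Type*} [Fintype H] [DecidableEq H] (L : Matrix H H ℂ) : ℝ :=
  (1 / 2) * (cfc Real.sqrt (Lᴴ * L)).trace.re

/-- The support of a positive semidefinite operator, that is, its range. -/
def operatorSupport {H : Type*} [Fintype H] [DecidableEq H] (ρ : Matrix H H ℂ) :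
    Submodule ℂ (EuclideanSpace ℂ H) :=
  LinearMap.range (Matrix.toEuclideanLin ρ)

/-- The tensor product of `n` operators on the space of `H`. -/
def tensorOp {H : Type*} {n : ℕ} (M : Fin n → Matrix H H ℂ) :
    Matrix (Fin n → H) (Fin n → H) ℂ :=
  Matrix.of fun x y => ∏ i, M i (x i) (y i)

/-- The tensor product of `n` vectors in the space of `H`. -/
def tensorVec {H : Type*} {n : ℕ} (v : Fin n → H → ℂ) : (Fin n → H) → ℂ :=
  fun x => ∏ i, v i (x i)

theorem tensorOp_mul {H : Type*} [Fintype H] {n : ℕ} (M N : Fin n → Matrix H H ℂ) :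
    tensorOp (fun i => M i * N i) = tensorOp M * tensorOp N := by
  classical
  ext x y
  simp only [tensorOp, Matrix.of_apply, Matrix.mul_apply, ← Finset.prod_mul_distrib]
  rw [Finset.prod_univ_sum]
  simp

theorem tensorOp_posSemidef {H : Type*} [Fintype H] {n : ℕ} {M : Fin n → Matrix H H ℂ}
    (hM : ∀ i, (M i).PosSemidef) : (tensorOp M).PosSemidef := by
  classical
  have h0 : ∀ i, ∃ N : Matrix H H ℂ, M i = Nᴴ * N := fun i => by
    open scoped MatrixOrder in
    exact CStarAlgebra.nonneg_iff_eq_star_mul_self.mp (hM i).nonneg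
  choose N hN using h0
  have h1 : tensorOp M = (tensorOp N)ᴴ * tensorOp N := by
    have h2 : (tensorOp N)ᴴ = tensorOp (fun i => (N i)ᴴ) := by
      ext x y
      simp [tensorOp, Matrix.conjTranspose_apply]
    rw [h2, ← tensorOp_mul]
    congr 1
    funext i
    exact hN i
  rw [h1]
  exact Matrix.posSemidef_conjTranspose_mul_self _

theorem tensorOp_isPOVM {Y H : Type*} [Fintype Y] [DecidableEq Y] [Fintype H] [DecidableEq H]
    {n : ℕ} {P : Fin n → Y → Matrix H H ℂ} (hP : ∀ i, IsPOVM (P i)) :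
    IsPOVM (fun y : Fin n → Y => tensorOp fun i => P i (y i)) := by
  refine ⟨fun y => tensorOp_posSemidef fun i => (hP i).1 (y i), ?_⟩
  ext a b
  have h1 : ∀ i, ∑ y, P i y (a i) (b i) = (1 : Matrix H H ℂ) (a i) (b i) := by
    intro i
    rw [← (hP i).2, Matrix.sum_apply]
  have h2 : ∑ y : Fin n → Y, ∏ i, P i (y i) (a i) (b i)
      = ∏ i, ∑ y, P i y (a i) (b i) := by
    rw [Finset.prod_univ_sum]
    simp
  simp only [Matrix.sum_apply, tensorOp, Matrix.of_apply]
  rw [h2, Finset.prod_congr rfl fun i _ => h1 i]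
  by_cases hab : a = b
  · subst hab
    simp
  · obtain ⟨i, hi⟩ := Function.ne_iff.1 hab
    rw [Matrix.one_apply_ne hab]
    exact Finset.prod_eq_zero (Finset.mem_univ i) (Matrix.one_apply_ne hi)

/-! ### Monogamy-of-entanglement games -/

/-- A monogamy-of-entanglement game with questions `Θ`, answers `Y` and register `A` for Alice:
a probability distribution on the questions, and for each question a POVM for Alice. -/
structure MoEGame (Θ Y A : Type*) [Fintype Θ] [Fintype Y] [DecidableEq A] where
  prob : Θ → ℝ
  prob_nonneg : ∀ θ, 0 ≤ prob θ
  prob_sum : ∑ θ, prob θ = 1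
  meas : Θ → Y → Matrix A A ℂ
  meas_povm : ∀ θ, IsPOVM (meas θ)

/-- A quantum strategy: for each question a POVM for Bob and one for Charlie, and a shared state. -/
structure MoEStrategy (Θ Y A B C : Type*) [Fintype Y] [Fintype A]
    [Fintype B] [DecidableEq B] [Fintype C] [DecidableEq C] where
  bob : Θ → Y → Matrix B B ℂ
  bob_povm : ∀ θ, IsPOVM (bob θ)
  charlie : Θ → Y → Matrix C C ℂ
  charlie_povm : ∀ θ, IsPOVM (charlie θ)
  state : Matrix (A × B × C) (A × B × C) ℂ
  state_density : IsDensityOperator state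

/-- The `n`-fold parallel repetition of a game. -/
def MoEGame.parallel {Θ Y A : Type*} [Fintype Θ] [Fintype Y] [DecidableEq Y]
    [Fintype A] [DecidableEq A] (G : MoEGame Θ Y A) (n : ℕ) :
    MoEGame (Fin n → Θ) (Fin n → Y) (Fin n → A) where
  prob θ := ∏ i, G.prob (θ i)
  prob_nonneg θ := Finset.prod_nonneg fun i _ => G.prob_nonneg (θ i)
  prob_sum := by
    classical
    have h : ∑ θ : Fin n → Θ, ∏ i, G.prob (θ i) = ∏ _i : Fin n, ∑ θ, G.prob θ := by
      rw [Finset.prod_univ_sum]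
      simp
    rw [h, G.prob_sum]
    simp
  meas θ y := tensorOp fun i => G.meas (θ i) (y i)
  meas_povm θ := tensorOp_isPOVM fun i => G.meas_povm (θ i)

/-- The measurement of the `i`-th answer only: the sum of the `P x` over the `x` with `x i = y`. -/
def coordMeas {Y H : Type*} [Fintype Y] [DecidableEq Y] {n : ℕ}
    (P : (Fin n → Y) → Matrix H H ℂ) (i : Fin n) (y : Y) : Matrix H H ℂ :=
  ∑ x with x i = y, P x

/-- The `i`-th winning probability of a strategy for the `n`-fold parallel repetition of `G`. -/
def MoEGame.coordWinProb {Θ Y A B C : Type*} [Fintype Θ] [Fintype Y] [DecidableEq Y]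
    [Fintype A] [DecidableEq A] [Fintype B] [DecidableEq B] [Fintype C] [DecidableEq C]
    (G : MoEGame Θ Y A) {n : ℕ}
    (S : MoEStrategy (Fin n → Θ) (Fin n → Y) (Fin n → A) B C) (i : Fin n) : ℝ :=
  ∑ θ, (G.parallel n).prob θ * ∑ y,
    (((coordMeas ((G.parallel n).meas θ) i y) ⊗ₖ
      ((coordMeas (S.bob θ) i y) ⊗ₖ (coordMeas (S.charlie θ) i y))) * S.state).trace.re

/-! ### Qubits and the TFKW game -/

/-- The Hadamard operator. -/
def hadamardOp : Matrix (Fin 2) (Fin 2) ℂ :=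
  ((1 / Real.sqrt 2 : ℝ) : ℂ) • !![1, 1; 1, -1]

/-- The Pauli operator `X`. -/
def pauliX : Matrix (Fin 2) (Fin 2) ℂ := !![0, 1; 1, 0]

/-- The Pauli operator `Z`. -/
def pauliZ : Matrix (Fin 2) (Fin 2) ℂ := !![1, 0; 0, -1]

/-- The Breidbart operator, the Hermitian unitary which diagonalises the Hadamard operator. -/
def breidbartOp : Matrix (Fin 2) (Fin 2) ℂ :=
  !![(Real.cos (Real.pi / 8) : ℂ), (Real.sin (Real.pi / 8) : ℂ);
     (Real.sin (Real.pi / 8) : ℂ), -(Real.cos (Real.pi / 8) : ℂ)]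

/-- The computational basis vector `|y⟩`. -/
def qubitKet (y : Fin 2) : Fin 2 → ℂ := Pi.single y 1

/-- The conjugate-coding state `|y^θ⟩ = H^θ |y⟩`. -/
def conjugateCodingKet (θ y : Fin 2) : Fin 2 → ℂ :=
  (hadamardOp ^ (θ : ℕ)) *ᵥ qubitKet y

/-- The Breidbart state. -/
def breidbartState : Fin 2 → ℂ := breidbartOp *ᵥ qubitKet 0

/-- The single-qubit Wiesner-Breidbart state `X^{s₀} Z^{s₁} |β⟩`. -/
def wiesnerBreidbart (s : Fin 2 → Fin 2) : Fin 2 → ℂ :=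
  (pauliX ^ (s 0 : ℕ) * pauliZ ^ (s 1 : ℕ)) *ᵥ breidbartState

theorem conjugateCoding_isPOVM (θ : Fin 2) :
    IsPOVM (fun y => ketbra (conjugateCodingKet θ y)) := by
  refine ⟨fun y => Matrix.posSemidef_vecMulVec_self_star _, ?_⟩
  have h2 : ((Real.sqrt 2 : ℝ) : ℂ)⁻¹ * ((Real.sqrt 2 : ℝ) : ℂ)⁻¹ = 2⁻¹ := by
    rw [← mul_inv, ← Complex.ofReal_mul, Real.mul_self_sqrt (by norm_num)]
    norm_num
  ext i j
  fin_cases θ <;> fin_cases i <;> fin_cases j <;>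
    simp [ketbra, conjugateCodingKet, qubitKet, hadamardOp, Matrix.vecMulVec_apply,
      Fin.sum_univ_two, h2] <;> norm_num

/-- The TFKW game: a uniformly random question `θ`, on which Alice measures her qubit in the
conjugate-coding basis `|y^θ⟩`. -/
def tfkwGame : MoEGame (Fin 2) (Fin 2) (Fin 2) where
  prob _ := 1 / 2
  prob_nonneg _ := by norm_num
  prob_sum := by norm_num [Fin.sum_univ_two]
  meas θ y := ketbra (conjugateCodingKet θ y)
  meas_povm := conjugateCoding_isPOVM

/-! ### Combinations of Wiesner-Breidbart states -/

/-- The vectors `ψ t` in `B ⊗ C ⊗ R` have pairwise orthogonal supports on `B` and on `C`: their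
reduced operators on `B` have pairwise orthogonal supports, and so do those on `C`. -/
def HasOrthogonalSupports {T B C R : Type*} [Fintype B] [DecidableEq B] [Fintype C] [DecidableEq C]
    [Fintype R] (ψ : T → B × C × R → ℂ) : Prop :=
  ∀ t t', t ≠ t' →
    (operatorSupport (partialTraceRight (ketbra (ψ t))) ⟂
      operatorSupport (partialTraceRight (ketbra (ψ t')))) ∧
    (operatorSupport (partialTraceRight (partialTraceLeft (ketbra (ψ t)))) ⟂
      operatorSupport (partialTraceRight (partialTraceLeft (ketbra (ψ t')))))

/-- The vector `∑ t, X^{t₁₀} Z^{t₁₁}|β⟩ ⊗ ⋯ ⊗ X^{tₙ₀} Z^{tₙ₁}|β⟩ ⊗ |ψ t⟩`, with its registers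
bracketed as `(Aⁿ B C) R`. -/
def wiesnerBreidbartCombination {n : ℕ} {B C R : Type*}
    (ψ : (Fin n → Fin 2 → Fin 2) → B × C × R → ℂ) : ((Fin n → Fin 2) × B × C) × R → ℂ :=
  fun p => ∑ t, tensorVec (fun i => wiesnerBreidbart (t i)) p.1.1 * ψ t (p.1.2.1, p.1.2.2, p.2)

end

/-! Purify the state as `M * Mᴴ` and regard `coeffVec M` as a unit vector `v` of a real Euclidean
space, the real inner product being the real part of the complex one. Let `a`, `a'` be Alice's Pauli
observables at one site for the two possible questions, and let `b`, `c` and `b'`, `c'` be the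
observables of Bob's and Charlie's answers at that site on two questions differing there. Crossing
the parties, `b` and `c'` commute with each other and with Alice, so the anticommutation of `a` and
`a'` gives `‖a b v + a' c' v‖² = ‖b v‖² + ‖c' v‖² ≤ 2`. Hence the average of `a b + a' c'` is at
most `√2`, and likewise for `a c + a' b'`. Adding the trivial bounds on the averages of `b c` and
`b' c'` yields the value `cos²(π/8)`, and the loss in winning probability is exactly a sum of
nonnegative defects (`roundDefect_eq`). Small loss therefore forces `b v ≈ c v` and `(a b + a' c') v
≈ √2 v`.

Averaging gives a question `θ` for which all rounds around `θ` and around its complement `θ'` have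
small total defect (`exists_sum_siteDefect_le`). These rounds involve different auxiliary questions,
but at each site they share Alice's operators, so Bob's observable for `θ` and Charlie's for `θ'`
still almost satisfy the relation (`deviation_le_of_rounds`).

Bob measures `θ` and then `θ'`; Charlie measures `θ'` and then `θ`; both record their outcomes. The
two first measurements give labels for which Alice's state must be the Wiesner-Breidbart state
(`sum_norm_sub_projection_sq_le`). The remaining point is that the later measurements still agree
with the other party's earlier ones, although a party's two measurements need not commute. Here the
relation helps: given the outcome for `θ`, both parties' observables for `θ'` act like the same
operator of Alice (`sum_agreementDefect_le`). Projecting onto equal records and the matching Alice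
states gives vectors with orthogonal supports, and `sum_norm_sub_ite_sq_le` bounds the squared
distance by a multiple of `n² ε`. Normalisation and a passage to the trace norm finish the proof. -/

open scoped InnerProductSpace

noncomputable section

/-! ### Anticommuting pairs and the defects of a round. -/

section Operators

variable {E : Type*} [NormedAddCommGroup E] [InnerProductSpace ℝ E]

/-- Two anticommuting symmetric involutions. -/
structure AnticommutingPair (a a' : Module.End ℝ E) : Prop where
  symm : a.IsSymmetric
  symm' : a'.IsSymmetric
  sq : a * a = 1
  sq' : a' * a' = 1
  anti : a * a' = -(a' * a)

theorem AnticommutingPair.swap {a a' : Module.End ℝ E} (h : AnticommutingPair a a') :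
    AnticommutingPair a' a :=
  ⟨h.symm', h.symm, h.sq', h.sq, by rw [h.anti, neg_neg]⟩

/-- A symmetric contraction. -/
structure IsObservable (b : Module.End ℝ E) : Prop where
  symm : b.IsSymmetric
  contr : ∀ v, ‖b v‖ ^ 2 ≤ ‖v‖ ^ 2

theorem Commute.end_apply {f g : Module.End ℝ E} (h : Commute f g) (v : E) :
    f (g v) = g (f v) :=
  LinearMap.congr_fun h.eq v

theorem norm_sq_of_involution {a : Module.End ℝ E} (hs : a.IsSymmetric) (h : a * a = 1) (v : E) :
    ‖a v‖ ^ 2 = ‖v‖ ^ 2 := by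
  rw [← real_inner_self_eq_norm_sq, hs, ← Module.End.mul_apply, h, Module.End.one_apply,
    real_inner_self_eq_norm_sq]

theorem norm_add_sq_le_two (x y : E) : ‖x + y‖ ^ 2 ≤ 2 * ‖x‖ ^ 2 + 2 * ‖y‖ ^ 2 := by
  have := parallelogram_law_with_norm ℝ x y
  nlinarith [sq_nonneg ‖x - y‖]

theorem norm_sub_sq_le_two (x y : E) : ‖x - y‖ ^ 2 ≤ 2 * ‖x‖ ^ 2 + 2 * ‖y‖ ^ 2 := by
  have := norm_add_sq_le_two x (-y)
  rwa [← sub_eq_add_neg, norm_neg] at this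

/-- The product `a a'` is antisymmetric and commutes with the symmetric operator `d e`, so `a a' d
e` is antisymmetric and its quadratic form vanishes. -/
theorem AnticommutingPair.inner_eq_zero {a a' d e : Module.End ℝ E} (h : AnticommutingPair a a')
    (hd : d.IsSymmetric) (he : e.IsSymmetric) (had : Commute a d) (hae : Commute a e)
    (had' : Commute a' d) (hae' : Commute a' e) (hde : Commute d e) (v : E) :
    ⟪a (d v), a' (e v)⟫_ℝ = 0 := by
  have hanti : ∀ w, a (a' w) = -a' (a w) := fun w => LinearMap.congr_fun h.anti w
  have h1 : ⟪a (d v), a' (e v)⟫_ℝ = -⟪a (d v), a' (e v)⟫_ℝ := by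
    conv_lhs => rw [h.symm, hanti, inner_neg_right, ← h.symm', had'.end_apply, hae.end_apply,
      ← he, ← hde.end_apply, hd, ← hae'.end_apply, ← had.end_apply, real_inner_comm]
  linarith

theorem AnticommutingPair.norm_sq_add {a a' b c : Module.End ℝ E} (h : AnticommutingPair a a')
    (hb : b.IsSymmetric) (hc : c.IsSymmetric) (hab : Commute a b) (hac : Commute a c)
    (hab' : Commute a' b) (hac' : Commute a' c) (hbc : Commute b c) (v : E) :
    ‖a (b v) + a' (c v)‖ ^ 2 = ‖b v‖ ^ 2 + ‖c v‖ ^ 2 := by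
  rw [norm_add_sq_real, h.inner_eq_zero hb hc hab hac hab' hac' hbc,
    norm_sq_of_involution h.symm h.sq, norm_sq_of_involution h.symm' h.sq']
  ring

theorem sqrt_two_sub_norm_sq (v w : E) :
    ‖√2 • v - w‖ ^ 2 = 2 * ‖v‖ ^ 2 - 2 * √2 * ⟪v, w⟫_ℝ + ‖w‖ ^ 2 := by
  rw [norm_sub_sq_real, norm_smul, real_inner_smul_left, mul_pow, Real.norm_eq_abs, sq_abs,
    Real.sq_sqrt (by norm_num)]
  ring

/-- The operators of Bob and Charlie for a pair of questions that differ at one site, together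
with Alice's operators for that site. -/
structure IsRound (a a' b b' c c' : Module.End ℝ E) : Prop where
  pair : AnticommutingPair a a'
  obs_b : IsObservable b
  obs_b' : IsObservable b'
  obs_c : IsObservable c
  obs_c' : IsObservable c'
  ab : Commute a b
  ab' : Commute a b'
  ac : Commute a c
  ac' : Commute a c'
  a'b : Commute a' b
  a'b' : Commute a' b'
  a'c : Commute a' c
  a'c' : Commute a' c'
  bc : Commute b c
  bc' : Commute b c'
  b'c : Commute b' c
  b'c' : Commute b' c'

theorem IsRound.exchange {a a' b b' c c' : Module.End ℝ E} (h : IsRound a a' b b' c c') :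
    IsRound a a' c c' b b' :=
  ⟨h.pair, h.obs_c, h.obs_c', h.obs_b, h.obs_b', h.ac, h.ac', h.ab, h.ab', h.a'c, h.a'c', h.a'b,
    h.a'b', h.bc.symm, h.b'c.symm, h.bc'.symm, h.b'c'.symm⟩

/-- The defect of the relation `b = c` on `v`. -/
def agreementDefect (b c : Module.End ℝ E) (v : E) : ℝ := ‖v‖ ^ 2 - ⟪b v, c v⟫_ℝ

/-- The defect of the relation `a b + a' c = √2` on `v`. -/
def pairDefect (a a' b c : Module.End ℝ E) (v : E) : ℝ :=
  √2 * ‖v‖ ^ 2 - ⟪v, a (b v) + a' (c v)⟫_ℝ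

/-- The total defect of a round. -/
def roundDefect (a a' b b' c c' : Module.End ℝ E) (v : E) : ℝ :=
  pairDefect a a' b c' v + pairDefect a a' c b' v + agreementDefect b c v + agreementDefect b' c' v

theorem agreementDefect_comm (b c : Module.End ℝ E) (v : E) :
    agreementDefect b c v = agreementDefect c b v := by
  rw [agreementDefect, agreementDefect, real_inner_comm]

/-- Three nonnegative terms: the disagreement of `b` and `c`, and the failure of each to be an
isometry on `v`. The last two matter because POVM elements need not be projections. -/
theorem two_mul_agreementDefect (b c : Module.End ℝ E) (v : E) :
    2 * agreementDefect b c v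
      = ‖b v - c v‖ ^ 2 + (‖v‖ ^ 2 - ‖b v‖ ^ 2) + (‖v‖ ^ 2 - ‖c v‖ ^ 2) := by
  rw [agreementDefect, norm_sub_sq_real]
  ring

theorem agreementDefect_nonneg {b c : Module.End ℝ E} (hb : IsObservable b) (hc : IsObservable c)
    (v : E) : 0 ≤ agreementDefect b c v := by
  linarith [two_mul_agreementDefect b c v, hb.contr v, hc.contr v, sq_nonneg ‖b v - c v‖]

theorem norm_sub_sq_le_agreementDefect {b c : Module.End ℝ E} (hb : IsObservable b)
    (hc : IsObservable c) (v : E) : ‖b v - c v‖ ^ 2 ≤ 2 * agreementDefect b c v := by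
  linarith [two_mul_agreementDefect b c v, hb.contr v, hc.contr v]

theorem norm_sq_sub_le_agreementDefect {b c : Module.End ℝ E}
    (hc : IsObservable c) (v : E) : ‖v‖ ^ 2 - ‖b v‖ ^ 2 ≤ 2 * agreementDefect b c v := by
  linarith [two_mul_agreementDefect b c v, hc.contr v, sq_nonneg ‖b v - c v‖]

/-- Completing the square turns a near-maximal average into a near-eigenvector relation; the second
term is nonnegative once the cross term vanishes. -/
theorem two_sqrt_two_mul_pairDefect (a a' b c : Module.End ℝ E) (v : E) :
    2 * √2 * pairDefect a a' b c v
      = ‖√2 • v - (a (b v) + a' (c v))‖ ^ 2 + (2 * ‖v‖ ^ 2 - ‖a (b v) + a' (c v)‖ ^ 2) := by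
  have h2 : √2 * √2 = 2 := Real.mul_self_sqrt (by norm_num)
  rw [sqrt_two_sub_norm_sq, pairDefect]
  linear_combination 2 * ‖v‖ ^ 2 * h2

theorem IsRound.norm_sq {a a' b b' c c' : Module.End ℝ E} (h : IsRound a a' b b' c c') (v : E) :
    ‖a (b v) + a' (c' v)‖ ^ 2 = ‖b v‖ ^ 2 + ‖c' v‖ ^ 2 :=
  h.pair.norm_sq_add h.obs_b.symm h.obs_c'.symm h.ab h.ac' h.a'b h.a'c' h.bc' v

theorem IsRound.deviation_le {a a' b b' c c' : Module.End ℝ E} (h : IsRound a a' b b' c c')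
    (v : E) : ‖√2 • v - (a (b v) + a' (c' v))‖ ^ 2 ≤ 2 * √2 * pairDefect a a' b c' v := by
  rw [two_sqrt_two_mul_pairDefect, h.norm_sq]
  linarith [h.obs_b.contr v, h.obs_c'.contr v]

theorem IsRound.pairDefect_nonneg {a a' b b' c c' : Module.End ℝ E}
    (h : IsRound a a' b b' c c') (v : E) : 0 ≤ pairDefect a a' b c' v := by
  have h1 := (sq_nonneg _).trans (h.deviation_le v)
  exact nonneg_of_mul_nonneg_right h1 (by positivity)

theorem IsRound.roundDefect_nonneg {a a' b b' c c' : Module.End ℝ E}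
    (h : IsRound a a' b b' c c') (v : E) : 0 ≤ roundDefect a a' b b' c c' v := by
  have := h.pairDefect_nonneg v
  have := h.exchange.pairDefect_nonneg v
  have := agreementDefect_nonneg h.obs_b h.obs_c v
  have := agreementDefect_nonneg h.obs_b' h.obs_c' v
  unfold roundDefect
  linarith

theorem IsRound.agreementDefect_le {a a' b b' c c' : Module.End ℝ E}
    (h : IsRound a a' b b' c c') (v : E) :
    agreementDefect b c v ≤ roundDefect a a' b b' c c' v := by
  have := h.pairDefect_nonneg v
  have := h.exchange.pairDefect_nonneg v
  have := agreementDefect_nonneg h.obs_b' h.obs_c' v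
  unfold roundDefect
  linarith

theorem IsRound.agreementDefect_le' {a a' b b' c c' : Module.End ℝ E}
    (h : IsRound a a' b b' c c') (v : E) :
    agreementDefect b' c' v ≤ roundDefect a a' b b' c c' v := by
  have := h.pairDefect_nonneg v
  have := h.exchange.pairDefect_nonneg v
  have := agreementDefect_nonneg h.obs_b h.obs_c v
  unfold roundDefect
  linarith

theorem sqrt_two_le : √2 ≤ 3 / 2 := by
  rw [Real.sqrt_le_left (by norm_num)]
  norm_num

theorem IsRound.deviation_le_roundDefect {a a' b b' c c' : Module.End ℝ E}
    (h : IsRound a a' b b' c c') (v : E) :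
    ‖√2 • v - (a (b v) + a' (c' v))‖ ^ 2 ≤ 3 * roundDefect a a' b b' c c' v := by
  have h1 := h.deviation_le v
  have h0 := h.pairDefect_nonneg v
  have := h.exchange.pairDefect_nonneg v
  have := agreementDefect_nonneg h.obs_b h.obs_c v
  have := agreementDefect_nonneg h.obs_b' h.obs_c' v
  have h3 := sqrt_two_le
  have h4 : pairDefect a a' b c' v ≤ roundDefect a a' b b' c c' v := by
    unfold roundDefect
    linarith
  nlinarith

/-- Two rounds at the same site are almost consistent: Bob's operator of the one and Charlie's
operator of the other almost satisfy the relation of a single round. -/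
theorem deviation_le_of_rounds {a a' b₁ b₁' c₁ c₁' b₂ b₂' c₂ c₂' : Module.End ℝ E}
    (h₁ : IsRound a a' b₁ b₁' c₁ c₁') (h₂ : IsRound a a' b₂ b₂' c₂ c₂')
    (h₁₂ : Commute b₁ c₂') (h₂₁ : Commute b₂ c₁') (v : E) :
    ‖√2 • v - (a (b₁ v) + a' (c₂' v))‖ ^ 2
      ≤ 30 * (roundDefect a a' b₁ b₁' c₁ c₁' v + roundDefect a a' b₂ b₂' c₂ c₂' v) := by
  have hd : (b₂ - b₁).IsSymmetric := h₂.obs_b.symm.sub h₁.obs_b.symm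
  have he : (c₂' - c₁').IsSymmetric := h₂.obs_c'.symm.sub h₁.obs_c'.symm
  have h5 : Commute (b₂ - b₁) (c₂' - c₁') :=
    (h₂.bc'.sub_left h₁₂).sub_right (h₂₁.sub_left h₁.bc')
  have h6 := h₁.pair.norm_sq_add hd he (h₂.ab.sub_right h₁.ab) (h₂.ac'.sub_right h₁.ac')
    (h₂.a'b.sub_right h₁.a'b) (h₂.a'c'.sub_right h₁.a'c') h5 v
  simp only [LinearMap.sub_apply] at h6
  -- The difference of the two relations has the form `a d + a' e` with commuting `d`, `e`, so its
  -- norm controls `d` and `e` separately.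
  have h7 : a (b₂ v - b₁ v) + a' (c₂' v - c₁' v)
      = (√2 • v - (a (b₁ v) + a' (c₁' v))) - (√2 • v - (a (b₂ v) + a' (c₂' v))) := by
    rw [map_sub, map_sub]; abel
  rw [h7] at h6
  have h8 : ‖c₂' v - c₁' v‖ ^ 2 ≤ 2 * ‖√2 • v - (a (b₁ v) + a' (c₁' v))‖ ^ 2
      + 2 * ‖√2 • v - (a (b₂ v) + a' (c₂' v))‖ ^ 2 := by
    have := norm_sub_sq_le_two (√2 • v - (a (b₁ v) + a' (c₁' v)))
      (√2 • v - (a (b₂ v) + a' (c₂' v)))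
    nlinarith [sq_nonneg ‖b₂ v - b₁ v‖]
  have h9 : √2 • v - (a (b₁ v) + a' (c₂' v))
      = (√2 • v - (a (b₁ v) + a' (c₁' v))) - a' (c₂' v - c₁' v) := by
    rw [map_sub]; abel
  have h10 := norm_sub_sq_le_two (√2 • v - (a (b₁ v) + a' (c₁' v))) (a' (c₂' v - c₁' v))
  rw [← h9, norm_sq_of_involution h₁.pair.symm' h₁.pair.sq'] at h10
  have h11 := h₁.deviation_le_roundDefect v
  -- The deviation is at most six times that of the first round plus four times that of the second,
  -- and each of these is at most three defects; 30 is a common upper bound.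
  have h12 := h₂.deviation_le_roundDefect v
  have h13 := h₁.roundDefect_nonneg v
  have h14 := h₂.roundDefect_nonneg v
  linarith

end Operators

/-! ### Outcome signs and commuting measurements. -/

/-- The sign of an outcome. -/
def outcomeSign (y : Fin 2) : ℝ := (-1) ^ (y : ℕ)

theorem outcomeSign_sq (y : Fin 2) : outcomeSign y * outcomeSign y = 1 := by
  fin_cases y <;> simp [outcomeSign]

theorem outcomeSign_abs (y : Fin 2) : |outcomeSign y| = 1 := by
  fin_cases y <;> simp [outcomeSign]

/-- A union bound over sites: each summand is the indicator that `x` and `y` differ there. It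
converts site-wise correlations into statements about whole strings. -/
theorem ite_ne_le_sum_sign {n : ℕ} (x y : Fin n → Fin 2) :
    (if x ≠ y then (1 : ℝ) else 0)
      ≤ ∑ i, (1 / 2) * (1 - outcomeSign (x i) * outcomeSign (y i)) := by
  have h0 : ∀ i, 0 ≤ (1 / 2) * (1 - outcomeSign (x i) * outcomeSign (y i)) := fun i => by
    generalize x i = s
    generalize y i = t
    fin_cases s <;> fin_cases t <;> norm_num [outcomeSign]
  by_cases h : x = y
  · simpa [h] using Finset.sum_nonneg fun i _ => (by simpa [h] using h0 i)
  · rw [if_pos h]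
    obtain ⟨i, hi⟩ := Function.ne_iff.1 h
    refine le_trans ?_ (Finset.single_le_sum (fun j _ => h0 j) (Finset.mem_univ i))
    generalize x i = s at hi
    generalize y i = t at hi
    fin_cases s <;> fin_cases t <;> first | exact absurd rfl hi | norm_num [outcomeSign]

section Measurements

variable {E : Type*} [NormedAddCommGroup E] [InnerProductSpace ℝ E] {X : Type*} [Fintype X]

/-- Symmetric operators whose squares sum to one. -/
structure IsKraus (K : X → Module.End ℝ E) : Prop where
  symm : ∀ x, (K x).IsSymmetric
  sum_sq : ∑ x, K x * K x = 1

theorem IsKraus.sum_inner_eq {K : X → Module.End ℝ E} (h : IsKraus K) (v w : E) :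
    ∑ x, ⟪K x v, K x w⟫_ℝ = ⟪v, w⟫_ℝ := by
  have h1 : ∀ x, ⟪K x v, K x w⟫_ℝ = ⟪v, (K x * K x) w⟫_ℝ := fun x => h.symm x _ _
  rw [Finset.sum_congr rfl fun x _ => h1 x, ← inner_sum, ← LinearMap.sum_apply, h.sum_sq,
    Module.End.one_apply]

theorem IsKraus.sum_norm_sq {K : X → Module.End ℝ E} (h : IsKraus K) (v : E) :
    ∑ x, ‖K x v‖ ^ 2 = ‖v‖ ^ 2 := by
  simpa only [real_inner_self_eq_norm_sq] using h.sum_inner_eq v v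

theorem IsKraus.norm_sq_le {K : X → Module.End ℝ E} (h : IsKraus K) (x : X) (v : E) :
    ‖K x v‖ ^ 2 ≤ ‖v‖ ^ 2 := by
  rw [← h.sum_norm_sq v]
  exact Finset.single_le_sum (f := fun x => ‖K x v‖ ^ 2) (fun _ _ => sq_nonneg _)
    (Finset.mem_univ x)

variable {n : ℕ}

/-- The observable of the `i`-th outcome of the measurement with Kraus operators `K`. -/
def outcomeObs (K : (Fin n → Fin 2) → Module.End ℝ E) (i : Fin n) : Module.End ℝ E :=
  ∑ x, outcomeSign (x i) • (K x * K x)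

variable {K L : (Fin n → Fin 2) → Module.End ℝ E}

theorem IsKraus.inner_outcomeObs (h : IsKraus K) (i : Fin n) (v w : E) :
    ⟪outcomeObs K i v, w⟫_ℝ = ∑ x, outcomeSign (x i) * ⟪K x v, K x w⟫_ℝ := by
  simp only [outcomeObs, LinearMap.sum_apply, LinearMap.smul_apply, sum_inner,
    real_inner_smul_left, Module.End.mul_apply]
  exact Finset.sum_congr rfl fun x _ => by rw [h.symm]

/-- For the contraction bound, `‖O v‖² = ⟪O v, O v⟫` is a signed sum of `⟪K x v, K x (O v)⟫`, at
most half of `‖v‖² + ‖O v‖²`. -/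
theorem IsKraus.isObservable (h : IsKraus K) (i : Fin n) : IsObservable (outcomeObs K i) := by
  refine ⟨fun v w => ?_, fun v => ?_⟩
  · rw [h.inner_outcomeObs, real_inner_comm, h.inner_outcomeObs]
    exact Finset.sum_congr rfl fun x _ => by rw [real_inner_comm]
  · have h1 : ‖outcomeObs K i v‖ ^ 2
        ≤ ∑ x, (1 / 2) * (‖K x v‖ ^ 2 + ‖K x (outcomeObs K i v)‖ ^ 2) := by
      rw [← real_inner_self_eq_norm_sq, h.inner_outcomeObs]
      refine Finset.sum_le_sum fun x _ => ?_
      refine (le_abs_self _).trans ?_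
      rw [abs_mul, outcomeSign_abs, one_mul]
      refine (abs_real_inner_le_norm _ _).trans ?_
      nlinarith [sq_nonneg (‖K x v‖ - ‖K x (outcomeObs K i v)‖)]
    rw [← Finset.mul_sum, Finset.sum_add_distrib, h.sum_norm_sq, h.sum_norm_sq] at h1
    linarith

theorem commute_outcomeObs {d : Module.End ℝ E} (h : ∀ x, Commute d (K x)) (i : Fin n) :
    Commute d (outcomeObs K i) :=
  Commute.sum_right _ _ _ fun x _ => ((h x).mul_right (h x)).smul_right _

theorem sum_sign_mul_norm_sq (hK : IsKraus K) (hL : IsKraus L)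
    (hKL : ∀ x y, Commute (K x) (L y)) (i : Fin n) (v : E) :
    ∑ x, ∑ y, outcomeSign (x i) * outcomeSign (y i) * ‖K x (L y v)‖ ^ 2
      = ⟪outcomeObs K i v, outcomeObs L i v⟫_ℝ := by
  rw [hK.inner_outcomeObs]
  refine Finset.sum_congr rfl fun x _ => ?_
  rw [← (commute_outcomeObs (hKL x) i).symm.end_apply, real_inner_comm, hL.inner_outcomeObs,
    Finset.mul_sum]
  refine Finset.sum_congr rfl fun y _ => ?_
  rw [real_inner_self_eq_norm_sq, (hKL x y).end_apply, mul_assoc]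

theorem sum_sum_norm_sq (hK : IsKraus K) (hL : IsKraus L) (v : E) :
    ∑ x, ∑ y, ‖K x (L y v)‖ ^ 2 = ‖v‖ ^ 2 := by
  rw [Finset.sum_comm, ← hL.sum_norm_sq v]
  exact Finset.sum_congr rfl fun y _ => hK.sum_norm_sq _

/-- The probability that two commuting measurements differ. -/
def mismatch (K L : (Fin n → Fin 2) → Module.End ℝ E) (v : E) : ℝ :=
  ∑ x, ∑ y, if x ≠ y then ‖K x (L y v)‖ ^ 2 else 0

/-- The union bound over sites, with the joint outcome distribution `‖K x (L y v)‖²` as weights; its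
site-wise correlations are the inner products of the observables. -/
theorem mismatch_le (hK : IsKraus K) (hL : IsKraus L)
    (hKL : ∀ x y, Commute (K x) (L y)) (v : E) :
    mismatch K L v
      ≤ ∑ i, (1 / 2) * agreementDefect (outcomeObs K i) (outcomeObs L i) v := by
  have h1 : ∀ i, (1 / 2) * agreementDefect (outcomeObs K i) (outcomeObs L i) v
      = ∑ x, ∑ y, (1 / 2) * (1 - outcomeSign (x i) * outcomeSign (y i))
        * ‖K x (L y v)‖ ^ 2 := fun i => by
    rw [agreementDefect, ← sum_sign_mul_norm_sq hK hL hKL, ← sum_sum_norm_sq hK hL v,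
      ← Finset.sum_sub_distrib, Finset.mul_sum]
    refine Finset.sum_congr rfl fun x _ => ?_
    rw [← Finset.sum_sub_distrib, Finset.mul_sum]
    refine Finset.sum_congr rfl fun y _ => ?_
    ring
  rw [Finset.sum_congr rfl fun i _ => h1 i, Finset.sum_comm, mismatch]
  refine Finset.sum_le_sum fun x _ => ?_
  rw [Finset.sum_comm]
  refine Finset.sum_le_sum fun y _ => ?_
  rw [← Finset.sum_mul]
  refine le_trans (le_of_eq ?_) (mul_le_mul_of_nonneg_right (ite_ne_le_sum_sign x y)
    (sq_nonneg _))
  split_ifs <;> simp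

/-- Two commuting measurements with positive Kraus operators that mostly agree act almost
in the same way. -/
theorem sum_norm_sub_sq_le {J G : (Fin n → Fin 2) → Module.End ℝ E}
    (hJ : ∀ x, (J x).IsSymmetric) (hG : ∀ x, (G x).IsSymmetric)
    (hK : IsKraus fun x => J x * J x) (hL : IsKraus fun x => G x * G x)
    (hJG : ∀ x y, Commute (J x) (G y)) (v : E) :
    ∑ x, ‖(J x * J x) v - (G x * G x) v‖ ^ 2
      ≤ 2 * mismatch (fun x => J x * J x) (fun x => G x * G x) v := by
  have hJc : ∀ x w, ‖J x w‖ ^ 2 ≤ ‖w‖ ^ 2 := fun x w => by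
    have h1 : ‖J x w‖ ^ 2 = ⟪w, (J x * J x) w⟫_ℝ := by
      rw [Module.End.mul_apply, ← hJ, real_inner_self_eq_norm_sq]
    have h2 := real_inner_le_norm w ((J x * J x) w)
    have h3 := hK.norm_sq_le x w
    nlinarith [sq_nonneg (‖w‖ - ‖(J x * J x) w‖)]
  have hGc : ∀ x w, ‖G x w‖ ^ 2 ≤ ‖w‖ ^ 2 := fun x w => by
    have h1 : ‖G x w‖ ^ 2 = ⟪w, (G x * G x) w⟫_ℝ := by
      rw [Module.End.mul_apply, ← hG, real_inner_self_eq_norm_sq]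
    have h2 := real_inner_le_norm w ((G x * G x) w)
    have h3 := hL.norm_sq_le x w
    nlinarith [sq_nonneg (‖w‖ - ‖(G x * G x) w‖)]
  -- This is where positivity of the Kraus operators enters, and why their square roots `J`, `G` are
  -- carried along: the inner product equals `‖J x (G x v)‖²`, and applying the contractions once
  -- more only decreases it.
  have h1 : ∀ x, ‖(J x * J x) ((G x * G x) v)‖ ^ 2 ≤ ⟪(J x * J x) v, (G x * G x) v⟫_ℝ := by
    intro x
    have h2 : ⟪(J x * J x) v, (G x * G x) v⟫_ℝ = ‖J x (G x v)‖ ^ 2 := by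
      rw [Module.End.mul_apply, Module.End.mul_apply, hJ, (hJG x x).end_apply, ← hG,
        ← (hJG x x).end_apply, real_inner_self_eq_norm_sq]
    rw [h2, Module.End.mul_apply, Module.End.mul_apply, (hJG x x).end_apply (G x v),
      (hJG x x).end_apply (J x (G x v))]
    exact (hGc _ _).trans (hJc _ _)
  -- The mismatch is one minus the probability of agreement, scaled by `‖v‖²`.
  have h4 : mismatch (fun x => J x * J x) (fun x => G x * G x) v
      = ‖v‖ ^ 2 - ∑ x, ‖(J x * J x) ((G x * G x) v)‖ ^ 2 := by
    rw [← sum_sum_norm_sq hK hL v, mismatch, ← Finset.sum_sub_distrib]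
    refine Finset.sum_congr rfl fun x _ => ?_
    have h5 : ∑ y, (if x = y then ‖(J x * J x) ((G y * G y) v)‖ ^ 2 else 0)
        = ‖(J x * J x) ((G x * G x) v)‖ ^ 2 := by simp
    rw [eq_sub_iff_add_eq, ← h5, ← Finset.sum_add_distrib]
    refine Finset.sum_congr rfl fun y _ => ?_
    by_cases h : x = y <;> simp [h]
  have h5 : ∀ x, ‖(J x * J x) v - (G x * G x) v‖ ^ 2
      ≤ ‖(J x * J x) v‖ ^ 2 + ‖(G x * G x) v‖ ^ 2
        - 2 * ‖(J x * J x) ((G x * G x) v)‖ ^ 2 := fun x => by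
    rw [norm_sub_sq_real]
    linarith [h1 x]
  refine (Finset.sum_le_sum fun x _ => h5 x).trans (le_of_eq ?_)
  rw [Finset.sum_sub_distrib, Finset.sum_add_distrib, hK.sum_norm_sq, hL.sum_norm_sq,
    ← Finset.mul_sum, h4]
  ring

/-- If the observable `c` agrees with the `i`-th outcome of the measurement `K`, then it takes the
observed value after that measurement. -/
theorem sum_norm_sub_sign_sq_le (hK : IsKraus K) {c : Module.End ℝ E} (hc : IsObservable c)
    (hKc : ∀ x, Commute (K x) c) (i : Fin n) (v : E) :
    ∑ x, ‖c (K x v) - outcomeSign (x i) • K x v‖ ^ 2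
      ≤ 2 * agreementDefect (outcomeObs K i) c v := by
  have h1 : ∀ x, ‖c (K x v) - outcomeSign (x i) • K x v‖ ^ 2
      ≤ 2 * ‖K x v‖ ^ 2 - 2 * (outcomeSign (x i) * ⟪K x v, K x (c v)⟫_ℝ) := fun x => by
    rw [norm_sub_sq_real, norm_smul, Real.norm_eq_abs, outcomeSign_abs, one_mul,
      real_inner_smul_right, ← (hKc x).end_apply, real_inner_comm, (hKc x).end_apply]
    linarith [hc.contr (K x v)]
  refine (Finset.sum_le_sum fun x _ => h1 x).trans (le_of_eq ?_)
  rw [Finset.sum_sub_distrib, ← Finset.mul_sum, ← Finset.mul_sum, hK.sum_norm_sq,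
    ← hK.inner_outcomeObs, agreementDefect]
  ring

end Measurements

/-! ### Persistence of agreement under further measurements. -/

section Measurements

variable {E : Type*} [NormedAddCommGroup E] [InnerProductSpace ℝ E]

theorem AnticommutingPair.norm_sq_le_six {a a' : Module.End ℝ E} (h : AnticommutingPair a a')
    (y : Fin 2) (w : E) :
    ‖a' (√2 • w - outcomeSign y • a w)‖ ^ 2 ≤ 6 * ‖w‖ ^ 2 := by
  rw [norm_sq_of_involution h.symm' h.sq']
  refine (norm_sub_sq_le_two _ _).trans (le_of_eq ?_)
  rw [norm_smul, norm_smul, mul_pow, mul_pow, norm_sq_of_involution h.symm h.sq,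
    Real.norm_eq_abs, Real.norm_eq_abs, outcomeSign_abs, sq_abs, Real.sq_sqrt (by norm_num)]
  ring

theorem norm_add_four_sq_le (x y z w : E) :
    ‖x + y + z + w‖ ^ 2 ≤ 4 * ‖x‖ ^ 2 + 4 * ‖y‖ ^ 2 + 4 * ‖z‖ ^ 2 + 4 * ‖w‖ ^ 2 := by
  have h1 := norm_add_sq_le_two (x + y) (z + w)
  have h2 := norm_add_sq_le_two x y
  have h3 := norm_add_sq_le_two z w
  rw [← add_assoc] at h1
  linarith

variable {n : ℕ} {K L K' L' : (Fin n → Fin 2) → Module.End ℝ E} {a a' b c d : Module.End ℝ E}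

/-- An operator that Alice can simulate given an outcome is, after a measurement which reveals that
outcome, close to Alice's operator for the observed value. -/
theorem sum_simulation_sq_le (hK : IsKraus K) (h : AnticommutingPair a a') (hc : IsObservable c)
    (hKa : ∀ x, Commute (K x) a) (hKa' : ∀ x, Commute (K x) a') (hKc : ∀ x, Commute (K x) c)
    (hKd : ∀ x, Commute (K x) d) (i : Fin n) (v : E) :
    ∑ x, ‖d (K x v) - a' (√2 • K x v - outcomeSign (x i) • a (K x v))‖ ^ 2
      ≤ 2 * ‖d v - a' (√2 • v - a (c v))‖ ^ 2 + 4 * agreementDefect (outcomeObs K i) c v := by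
  have h1 : ∀ x, ‖d (K x v) - a' (√2 • K x v - outcomeSign (x i) • a (K x v))‖ ^ 2
      ≤ 2 * ‖K x (d v - a' (√2 • v - a (c v)))‖ ^ 2
        + 2 * ‖c (K x v) - outcomeSign (x i) • K x v‖ ^ 2 := fun x => by
    -- Since `K x` commutes with all operators present, it acts on the error at `v`; what is left is
    -- the replacement of `c` by the sign of the observed outcome.
    have h2 : d (K x v) - a' (√2 • K x v - outcomeSign (x i) • a (K x v))
        = K x (d v - a' (√2 • v - a (c v))) - a' (a (c (K x v) - outcomeSign (x i) • K x v)) := by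
      simp only [map_sub, map_smul, (hKd x).end_apply, (hKa' x).end_apply, (hKa x).end_apply,
        (hKc x).end_apply]
      abel
    rw [h2]
    refine (norm_sub_sq_le_two _ _).trans (le_of_eq ?_)
    rw [norm_sq_of_involution h.symm' h.sq', norm_sq_of_involution h.symm h.sq]
  refine (Finset.sum_le_sum fun x _ => h1 x).trans ?_
  rw [Finset.sum_add_distrib, ← Finset.mul_sum, ← Finset.mul_sum, hK.sum_norm_sq]
  linarith [sum_norm_sub_sign_sq_le hK hc hKc i v]

/-- The operators of the second measurement still agree after the first one. -/
theorem sum_agreementDefect_le (hK : IsKraus K) (hL : IsKraus L) (h : AnticommutingPair a a')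
    (hb : IsObservable b) (hc : IsObservable c)
    (hKa : ∀ x, Commute (K x) a) (hKa' : ∀ x, Commute (K x) a')
    (hLa : ∀ x, Commute (L x) a) (hLa' : ∀ x, Commute (L x) a')
    (hKL : ∀ x y, Commute (K x) (L y))
    (hKc : ∀ x, Commute (K x) c) (hLb : ∀ x, Commute (L x) b) (i : Fin n) (v : E) :
    ∑ x, agreementDefect b c (K x v)
      ≤ 15 * ∑ x, ‖K x v - L x v‖ ^ 2
        + 16 * ‖√2 • v - (a (outcomeObs K i v) + a' (c v))‖ ^ 2
        + 32 * agreementDefect (outcomeObs K i) (outcomeObs L i) v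
        + 20 * agreementDefect b c v := by
  set p := outcomeObs K i with hp
  set q := outcomeObs L i with hq
  have hpo : IsObservable p := hK.isObservable i
  have hqo : IsObservable q := hL.isObservable i
  have ha'a' : ∀ w, a' (a' w) = w := fun w => LinearMap.congr_fun h.sq' w
  have hpq0 := agreementDefect_nonneg hpo hqo v
  have hbc0 := agreementDefect_nonneg hb hc v
  -- Solving the relation for `a' c` expresses `c` through Alice and the first outcome. The version
  -- with `q` is used after `K`, which commutes with `q` and `c`; the version for `b` with `p` is
  -- used after `L`, which commutes with `p` and `b`.
  have h1 : ‖c v - a' (√2 • v - a (q v))‖ ^ 2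
      ≤ 2 * ‖√2 • v - (a (p v) + a' (c v))‖ ^ 2 + 4 * agreementDefect p q v := by
    have h2 : c v - a' (√2 • v - a (q v))
        = a' (-(√2 • v - (a (p v) + a' (c v))) - a (p v - q v)) := by
      conv_lhs => rw [← ha'a' (c v), ← map_sub]
      congr 1
      rw [map_sub]
      abel
    rw [h2, norm_sq_of_involution h.symm' h.sq']
    refine (norm_sub_sq_le_two _ _).trans ?_
    rw [norm_neg, norm_sq_of_involution h.symm h.sq]
    linarith [norm_sub_sq_le_agreementDefect hpo hqo v]
  have h3 : ‖b v - a' (√2 • v - a (p v))‖ ^ 2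
      ≤ 2 * ‖√2 • v - (a (p v) + a' (c v))‖ ^ 2 + 4 * agreementDefect b c v := by
    have h2 : b v - a' (√2 • v - a (p v))
        = (b v - c v) - a' (√2 • v - (a (p v) + a' (c v))) := by
      simp only [map_sub, map_add, ha'a']
      abel
    rw [h2]
    refine (norm_sub_sq_le_two _ _).trans ?_
    rw [norm_sq_of_involution h.symm' h.sq']
    linarith [norm_sub_sq_le_agreementDefect hb hc v]
  have hKq : ∀ x, Commute (K x) q := fun x => commute_outcomeObs (hKL x) i
  have hLp : ∀ x, Commute (L x) p := fun x => commute_outcomeObs (fun y => (hKL y x).symm) i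
  have h4 := sum_simulation_sq_le hK h hqo hKa hKa' hKq hKc i v
  have h5 := sum_simulation_sq_le hL h hpo hLa hLa' hLp hLb i v
  rw [agreementDefect_comm (outcomeObs L i)] at h5
  -- `K x` need not commute with `b`, so `K x v` is replaced by `L x v` to evaluate `b`, and Alice's
  -- operator is carried back to `K x v`. The constant is `28 = 4 * (1 + 6)`.
  have h6 : ∀ x, ‖b (K x v) - c (K x v)‖ ^ 2 ≤ 28 * ‖K x v - L x v‖ ^ 2
      + 4 * ‖c (K x v) - a' (√2 • K x v - outcomeSign (x i) • a (K x v))‖ ^ 2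
      + 4 * ‖b (L x v) - a' (√2 • L x v - outcomeSign (x i) • a (L x v))‖ ^ 2 := fun x => by
    have h7 : b (K x v) - c (K x v) = b (K x v - L x v)
        + (b (L x v) - a' (√2 • L x v - outcomeSign (x i) • a (L x v)))
        + (-a' (√2 • (K x v - L x v) - outcomeSign (x i) • a (K x v - L x v)))
        + (-(c (K x v) - a' (√2 • K x v - outcomeSign (x i) • a (K x v)))) := by
      simp only [map_sub, map_smul, smul_sub]
      abel
    rw [h7]
    refine (norm_add_four_sq_le _ _ _ _).trans ?_
    rw [norm_neg, norm_neg]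
    linarith [hb.contr (K x v - L x v), h.norm_sq_le_six (x i) (K x v - L x v)]
  -- The form `‖w‖² - ‖b w‖²` is nonnegative and obeys the parallelogram law, so its value at `K x
  -- v` is at most twice the sum of its values at `K x v - L x v` and `L x v`.
  have h8 : ∀ x, 2 * agreementDefect b c (K x v) ≤ ‖b (K x v) - c (K x v)‖ ^ 2
      + 2 * ‖K x v - L x v‖ ^ 2 + 2 * (‖L x v‖ ^ 2 - ‖L x (b v)‖ ^ 2)
      + (‖K x v‖ ^ 2 - ‖K x (c v)‖ ^ 2) := fun x => by
    rw [two_mul_agreementDefect, (hKc x).end_apply, (hLb x).end_apply]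
    have h9 := parallelogram_law_with_norm ℝ (K x v - L x v) (L x v)
    have h10 := parallelogram_law_with_norm ℝ (b (K x v - L x v)) (b (L x v))
    have h11 := hb.contr (K x v - L x v - L x v)
    rw [← map_add, ← map_sub] at h10
    rw [sub_add_cancel] at h9 h10
    nlinarith [sq_nonneg ‖b (K x v - L x v)‖]
  have h12 : 2 * ∑ x, agreementDefect b c (K x v) ≤ ∑ x, (30 * ‖K x v - L x v‖ ^ 2
      + 4 * ‖c (K x v) - a' (√2 • K x v - outcomeSign (x i) • a (K x v))‖ ^ 2
      + 4 * ‖b (L x v) - a' (√2 • L x v - outcomeSign (x i) • a (L x v))‖ ^ 2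
      + 2 * (‖L x v‖ ^ 2 - ‖L x (b v)‖ ^ 2) + (‖K x v‖ ^ 2 - ‖K x (c v)‖ ^ 2)) := by
    rw [Finset.mul_sum]
    exact Finset.sum_le_sum fun x _ => by linarith [h6 x, h8 x]
  simp only [Finset.sum_add_distrib, ← Finset.mul_sum, Finset.sum_sub_distrib, hK.sum_norm_sq,
    hL.sum_norm_sq] at h12
  have h13 := norm_sq_sub_le_agreementDefect (b := b) hc v
  have h14 := norm_sq_sub_le_agreementDefect (b := c) hb v
  rw [agreementDefect_comm] at h14
  linarith

theorem mismatch_comm (hKL : ∀ x y, Commute (K x) (L y)) (v : E) :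
    mismatch K L v = mismatch L K v := by
  rw [mismatch, Finset.sum_comm, mismatch]
  refine Finset.sum_congr rfl fun x _ => Finset.sum_congr rfl fun y _ => ?_
  rw [(hKL y x).end_apply]
  simp only [ne_comm]

/-- After a measurement `K` that almost agrees with `L`, the measurements `K'` and `L'` still almost
agree. -/
theorem sum_mismatch_le {J G : (Fin n → Fin 2) → Module.End ℝ E} {α α' : Fin n → Module.End ℝ E}
    (hJ : ∀ x, (J x).IsSymmetric) (hG : ∀ x, (G x).IsSymmetric)
    (hK : IsKraus fun x => J x * J x) (hL : IsKraus fun x => G x * G x)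
    (hK' : IsKraus K') (hL' : IsKraus L') (h : ∀ i, AnticommutingPair (α i) (α' i))
    (hJα : ∀ x i, Commute (J x) (α i)) (hJα' : ∀ x i, Commute (J x) (α' i))
    (hGα : ∀ x i, Commute (G x) (α i)) (hGα' : ∀ x i, Commute (G x) (α' i))
    (hJG : ∀ x y, Commute (J x) (G y)) (hJL' : ∀ x y, Commute (J x) (L' y))
    (hGK' : ∀ x y, Commute (G x) (K' y)) (hK'L' : ∀ x y, Commute (K' x) (L' y)) (v : E)
    {μ μ' δ : Fin n → ℝ}
    (hμ : ∀ i, agreementDefect (outcomeObs (fun x => J x * J x) i)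
      (outcomeObs (fun x => G x * G x) i) v ≤ μ i)
    (hμ' : ∀ i, agreementDefect (outcomeObs K' i) (outcomeObs L' i) v ≤ μ' i)
    (hδ : ∀ i, ‖√2 • v - (α i (outcomeObs (fun x => J x * J x) i v)
      + α' i (outcomeObs L' i v))‖ ^ 2 ≤ δ i) :
    ∑ x, mismatch K' L' ((J x * J x) v)
      ≤ (8 * n + 16) * ∑ i, μ i + 10 * ∑ i, μ' i + 8 * ∑ i, δ i := by
  have hKL : ∀ x y, Commute (J x * J x) (G y * G y) := fun x y =>
    ((hJG x y).mul_right (hJG x y)).mul_left ((hJG x y).mul_right (hJG x y))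
  have h1 := sum_norm_sub_sq_le hJ hG hK hL hJG v
  have h2 := mismatch_le hK hL hKL v
  rw [← Finset.mul_sum] at h2
  have h3 := Finset.sum_le_sum fun i (_ : i ∈ Finset.univ) => hμ i
  -- The replacement of `K x v` by `L x v` costs the full sum of `μ` at every site, which is the
  -- source of the factor `n`.
  have h4 : ∀ i, ∑ x, agreementDefect (outcomeObs K' i) (outcomeObs L' i) ((J x * J x) v)
      ≤ 15 * ∑ i, μ i + 16 * δ i + 32 * μ i + 20 * μ' i := fun i => by
    have h5 := sum_agreementDefect_le hK hL (h i) (hK'.isObservable i) (hL'.isObservable i)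
      (fun x => (hJα x i).mul_left (hJα x i)) (fun x => (hJα' x i).mul_left (hJα' x i))
      (fun x => (hGα x i).mul_left (hGα x i)) (fun x => (hGα' x i).mul_left (hGα' x i)) hKL
      (fun x => commute_outcomeObs (fun y => (hJL' x y).mul_left (hJL' x y)) i)
      (fun x => commute_outcomeObs (fun y => (hGK' x y).mul_left (hGK' x y)) i) i v
    linarith [hμ i, hμ' i, hδ i]
  calc ∑ x, mismatch K' L' ((J x * J x) v)
      ≤ ∑ x, ∑ i, (1 / 2) * agreementDefect (outcomeObs K' i) (outcomeObs L' i) ((J x * J x) v) :=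
        Finset.sum_le_sum fun x _ => mismatch_le hK' hL' hK'L' _
    _ = ∑ i, (1 / 2) * ∑ x, agreementDefect (outcomeObs K' i) (outcomeObs L' i)
          ((J x * J x) v) := by
        rw [Finset.sum_comm]
        simp only [Finset.mul_sum]
    _ ≤ ∑ i, (1 / 2) * (15 * ∑ i, μ i + 16 * δ i + 32 * μ i + 20 * μ' i) :=
        Finset.sum_le_sum fun i _ => by linarith [h4 i]
    _ = (15 / 2 * n + 16) * ∑ i, μ i + 10 * ∑ i, μ' i + 8 * ∑ i, δ i := by
        simp only [← Finset.mul_sum, Finset.sum_add_distrib, Finset.sum_const, Finset.card_univ,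
          Fintype.card_fin, nsmul_eq_mul]
        ring
    _ ≤ _ := by
        have h6 : 0 ≤ ∑ i, μ i := Finset.sum_nonneg fun i _ =>
          (agreementDefect_nonneg (hK.isObservable i) (hL.isObservable i) v).trans (hμ i)
        have h7 : (0 : ℝ) ≤ n := Nat.cast_nonneg n
        nlinarith [mul_nonneg h7 h6]

/-- Alice's state after the first measurements of Bob and Charlie. -/
theorem sum_norm_sub_projection_sq_le {α α' : Fin n → Module.End ℝ E}
    {P : (Fin n → Fin 2) → (Fin n → Fin 2) → Module.End ℝ E}
    (hK : IsKraus K) (hL' : IsKraus L') (h : ∀ i, AnticommutingPair (α i) (α' i))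
    (hKα : ∀ x i, Commute (K x) (α i)) (hKα' : ∀ x i, Commute (K x) (α' i))
    (hL'α : ∀ x i, Commute (L' x) (α i)) (hL'α' : ∀ x i, Commute (L' x) (α' i))
    (hKL' : ∀ x y, Commute (K x) (L' y))
    (hP : ∀ x y w, ‖w - P x y w‖ ^ 2 ≤ ∑ i, (1 / 2) * (‖w‖ ^ 2 - √2 / 2 *
      (outcomeSign (x i) * ⟪w, α i w⟫_ℝ + outcomeSign (y i) * ⟪w, α' i w⟫_ℝ))) (v : E)
    {μ μ' δ : Fin n → ℝ}
    (hμ : ∀ i, ‖v‖ ^ 2 - ‖outcomeObs K i v‖ ^ 2 ≤ 2 * μ i)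
    (hμ' : ∀ i, ‖v‖ ^ 2 - ‖outcomeObs L' i v‖ ^ 2 ≤ 2 * μ' i)
    (hδ : ∀ i, ‖√2 • v - (α i (outcomeObs K i v) + α' i (outcomeObs L' i v))‖ ^ 2 ≤ δ i) :
    ∑ x, ∑ y, ‖K x (L' y v) - P x y (K x (L' y v))‖ ^ 2
      ≤ ∑ i, δ i + 2 * ∑ i, μ i + 2 * ∑ i, μ' i := by
  have h2 : √2 * √2 = 2 := Real.mul_self_sqrt (by norm_num)
  have h3 : 1 ≤ √2 := Real.one_le_sqrt.2 (by norm_num)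
  -- Averaging over the outcomes turns signs into observables, so the expected infidelity at a site
  -- is a multiple of the pair defect of `K` and `L'`.
  have h1 : ∀ i, ∑ x, ∑ y, (1 / 2) * (‖K x (L' y v)‖ ^ 2 - √2 / 2 *
      (outcomeSign (x i) * ⟪K x (L' y v), α i (K x (L' y v))⟫_ℝ
        + outcomeSign (y i) * ⟪K x (L' y v), α' i (K x (L' y v))⟫_ℝ))
      = (√2 / 4) * pairDefect (α i) (α' i) (outcomeObs K i) (outcomeObs L' i) v := fun i => by
    have h4 : ∑ x, ∑ y, outcomeSign (x i) * ⟪K x (L' y v), α i (K x (L' y v))⟫_ℝ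
        = ⟪v, α i (outcomeObs K i v)⟫_ℝ := by
      rw [← (h i).symm, real_inner_comm, hK.inner_outcomeObs]
      refine Finset.sum_congr rfl fun x _ => ?_
      rw [← Finset.mul_sum, ← hL'.sum_inner_eq]
      refine congrArg _ (Finset.sum_congr rfl fun y _ => ?_)
      rw [(hKα x i).end_apply, (hL'α y i).end_apply, (hKL' x y).end_apply]
    have h5 : ∑ x, ∑ y, outcomeSign (y i) * ⟪K x (L' y v), α' i (K x (L' y v))⟫_ℝ
        = ⟪v, α' i (outcomeObs L' i v)⟫_ℝ := by
      rw [← (h i).symm', real_inner_comm, hL'.inner_outcomeObs, Finset.sum_comm]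
      refine Finset.sum_congr rfl fun y _ => ?_
      rw [← Finset.mul_sum, ← hK.sum_inner_eq]
      refine congrArg _ (Finset.sum_congr rfl fun x _ => ?_)
      rw [(hL'α' y i).end_apply, (hKα' x i).end_apply]
    simp only [← Finset.mul_sum, Finset.sum_sub_distrib, Finset.sum_add_distrib]
    simp only [← Finset.mul_sum] at h4 h5
    rw [h4, h5, sum_sum_norm_sq hK hL', pairDefect, inner_add_right]
    linear_combination (-1 / 4) * ‖v‖ ^ 2 * h2
  have h6 : ∀ i, (√2 / 4) * pairDefect (α i) (α' i) (outcomeObs K i) (outcomeObs L' i) v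
      ≤ δ i + 2 * μ i + 2 * μ' i := fun i => by
    have h7 := two_sqrt_two_mul_pairDefect (α i) (α' i) (outcomeObs K i) (outcomeObs L' i) v
    rw [(h i).norm_sq_add (hK.isObservable i).symm (hL'.isObservable i).symm
      (commute_outcomeObs (fun x => (hKα x i).symm) i)
      (commute_outcomeObs (fun x => (hL'α x i).symm) i)
      (commute_outcomeObs (fun x => (hKα' x i).symm) i)
      (commute_outcomeObs (fun x => (hL'α' x i).symm) i)
      (commute_outcomeObs (fun y => (commute_outcomeObs (fun x => (hKL' x y).symm) i).symm) i)]
      at h7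
    have h8 := (hK.isObservable i).contr v
    have h9 := (hL'.isObservable i).contr v
    have h10 := hδ i
    have h11 := hμ i
    have h12 := hμ' i
    have h13 := sq_nonneg ‖√2 • v - (α i (outcomeObs K i v) + α' i (outcomeObs L' i v))‖
    linarith
  calc ∑ x, ∑ y, ‖K x (L' y v) - P x y (K x (L' y v))‖ ^ 2
      ≤ ∑ x, ∑ y, ∑ i, (1 / 2) * (‖K x (L' y v)‖ ^ 2 - √2 / 2 *
      (outcomeSign (x i) * ⟪K x (L' y v), α i (K x (L' y v))⟫_ℝ
        + outcomeSign (y i) * ⟪K x (L' y v), α' i (K x (L' y v))⟫_ℝ)) :=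
        Finset.sum_le_sum fun x _ => Finset.sum_le_sum fun y _ => hP x y _
    _ = ∑ i, ∑ x, ∑ y, (1 / 2) * (‖K x (L' y v)‖ ^ 2 - √2 / 2 *
      (outcomeSign (x i) * ⟪K x (L' y v), α i (K x (L' y v))⟫_ℝ
        + outcomeSign (y i) * ⟪K x (L' y v), α' i (K x (L' y v))⟫_ℝ)) := by
        exact (Finset.sum_congr rfl fun x _ => Finset.sum_comm).trans Finset.sum_comm
    _ ≤ ∑ i, (δ i + 2 * μ i + 2 * μ' i) :=
        Finset.sum_le_sum fun i _ => (h1 i).le.trans (h6 i)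
    _ = _ := by
        rw [Finset.sum_add_distrib, Finset.sum_add_distrib, Finset.mul_sum, Finset.mul_sum]

/-- A failure is charged to `x' ≠ y'`, to `x ≠ y`, or, if both agree, to Alice's state. In each case
the measurements not involved are the last ones of their party and sum to the identity: `L` in the
first, `K'` in the second, both in the third. This is why the two parties measure in opposite
orders. -/
theorem sum_norm_sub_ite_sq_le_add {P : (Fin n → Fin 2) → (Fin n → Fin 2) → Module.End ℝ E}
    (hL : IsKraus L) (hK' : IsKraus K')
    (hKL : ∀ x y, Commute (K x) (L y)) (hKL' : ∀ x y, Commute (K x) (L' y))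
    (hK'L : ∀ x y, Commute (K' x) (L y))
    (hK'P : ∀ z x y, Commute (K' z) (P x y)) (hLP : ∀ z x y, Commute (L z) (P x y)) (v : E) :
    ∑ x, ∑ x', ∑ y, ∑ y', ‖K' x' (K x (L y (L' y' v)))
        - if x = y ∧ x' = y' then P x x' (K' x' (K x (L y (L' y' v)))) else 0‖ ^ 2
      ≤ ∑ x, mismatch K' L' (K x v) + ∑ y', mismatch L K (L' y' v)
        + ∑ x, ∑ y', ‖K x (L' y' v) - P x y' (K x (L' y' v))‖ ^ 2 := by
  have h1 : ∑ x, mismatch K' L' (K x v) = ∑ x, ∑ x', ∑ y, ∑ y',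
      if x' ≠ y' then ‖K' x' (K x (L y (L' y' v)))‖ ^ 2 else 0 := by
    refine Finset.sum_congr rfl fun x _ => Finset.sum_congr rfl fun x' _ => ?_
    rw [Finset.sum_comm]
    refine Finset.sum_congr rfl fun y' _ => ?_
    split_ifs
    · rw [← hL.sum_norm_sq]
      refine Finset.sum_congr rfl fun y _ => ?_
      rw [(hKL x y).end_apply, (hK'L x' y).end_apply, (hKL' x y').end_apply]
    · simp
  have h2 : ∑ y', mismatch L K (L' y' v) = ∑ x, ∑ x', ∑ y, ∑ y',
      if x ≠ y then ‖K' x' (K x (L y (L' y' v)))‖ ^ 2 else 0 := by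
    calc ∑ y', mismatch L K (L' y' v)
        = ∑ y', ∑ x, ∑ y, if x ≠ y then ‖K x (L y (L' y' v))‖ ^ 2 else 0 :=
          Finset.sum_congr rfl fun y' _ => (mismatch_comm hKL _).symm
      _ = ∑ x, ∑ y, ∑ y', if x ≠ y then ‖K x (L y (L' y' v))‖ ^ 2 else 0 := by
          rw [Finset.sum_comm]
          exact Finset.sum_congr rfl fun x _ => Finset.sum_comm
      _ = ∑ x, ∑ y, ∑ y', ∑ x', if x ≠ y then ‖K' x' (K x (L y (L' y' v)))‖ ^ 2 else 0 := by
          refine Finset.sum_congr rfl fun x _ => Finset.sum_congr rfl fun y _ =>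
            Finset.sum_congr rfl fun y' _ => ?_
          split_ifs
          · rw [hK'.sum_norm_sq]
          · simp
      _ = _ := by
          exact Finset.sum_congr rfl fun x _ =>
            (Finset.sum_congr rfl fun y _ => Finset.sum_comm).trans Finset.sum_comm
  have h3 : ∑ x, ∑ y', ‖K x (L' y' v) - P x y' (K x (L' y' v))‖ ^ 2
      = ∑ x, ∑ x', ∑ y, ∑ y', ‖K' x' (K x (L y (L' y' v)))
          - P x y' (K' x' (K x (L y (L' y' v))))‖ ^ 2 := by
    have h4 : ∀ x x' y y', ‖K' x' (K x (L y (L' y' v)))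
          - P x y' (K' x' (K x (L y (L' y' v))))‖ ^ 2
        = ‖L y (K' x' (K x (L' y' v) - P x y' (K x (L' y' v))))‖ ^ 2 := fun x x' y y' => by
      rw [(hKL x y).end_apply, (hK'L x' y).end_apply, ← (hLP y x y').end_apply,
        ← (hK'P x' x y').end_apply, map_sub, map_sub]
    simp only [h4]
    refine Finset.sum_congr rfl fun x _ => ?_
    rw [← Finset.sum_congr rfl fun x' _ => Finset.sum_comm]
    simp only [hL.sum_norm_sq]
    rw [Finset.sum_comm]
    simp only [hK'.sum_norm_sq]
  rw [h1, h2, h3]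
  simp only [← Finset.sum_add_distrib]
  refine Finset.sum_le_sum fun x _ => Finset.sum_le_sum fun x' _ => Finset.sum_le_sum fun y _ =>
    Finset.sum_le_sum fun y' _ => ?_
  by_cases hx : x = y
  · by_cases hx' : x' = y'
    · subst hx hx'
      simp
    · simp [hx, hx']
  · have := sq_nonneg ‖K' x' (K x (L y (L' y' v))) - P x y' (K' x' (K x (L y (L' y' v))))‖
    have h5 : 0 ≤ if x' ≠ y' then ‖K' x' (K x (L y (L' y' v)))‖ ^ 2 else 0 := by
      split_ifs <;> positivity
    rw [if_neg (fun h => hx h.1), if_pos hx, sub_zero]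
    linarith

/-- The state after both measurements of Bob and Charlie is close to its projection onto agreement
of the outcomes and the corresponding states of Alice. -/
theorem sum_norm_sub_ite_sq_le {J J' G G' : (Fin n → Fin 2) → Module.End ℝ E}
    {α α' : Fin n → Module.End ℝ E}
    {P : (Fin n → Fin 2) → (Fin n → Fin 2) → Module.End ℝ E}
    (hJ : ∀ x, (J x).IsSymmetric) (hG : ∀ x, (G x).IsSymmetric)
    (hJ' : ∀ x, (J' x).IsSymmetric) (hG' : ∀ x, (G' x).IsSymmetric)
    (hK : IsKraus fun x => J x * J x) (hL : IsKraus fun x => G x * G x)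
    (hK' : IsKraus fun x => J' x * J' x) (hL' : IsKraus fun x => G' x * G' x)
    (h : ∀ i, AnticommutingPair (α i) (α' i))
    (hJα : ∀ x i, Commute (J x) (α i)) (hJα' : ∀ x i, Commute (J x) (α' i))
    (hGα : ∀ x i, Commute (G x) (α i)) (hGα' : ∀ x i, Commute (G x) (α' i))
    (hJ'α : ∀ x i, Commute (J' x) (α i)) (hJ'α' : ∀ x i, Commute (J' x) (α' i))
    (hG'α : ∀ x i, Commute (G' x) (α i)) (hG'α' : ∀ x i, Commute (G' x) (α' i))
    (hJG : ∀ x y, Commute (J x) (G y)) (hJG' : ∀ x y, Commute (J x) (G' y))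
    (hJ'G : ∀ x y, Commute (J' x) (G y)) (hJ'G' : ∀ x y, Commute (J' x) (G' y))
    (hJ'P : ∀ z x y, Commute (J' z) (P x y)) (hGP : ∀ z x y, Commute (G z) (P x y))
    (hP : ∀ x y w, ‖w - P x y w‖ ^ 2 ≤ ∑ i, (1 / 2) * (‖w‖ ^ 2 - √2 / 2 *
      (outcomeSign (x i) * ⟪w, α i w⟫_ℝ + outcomeSign (y i) * ⟪w, α' i w⟫_ℝ))) (v : E)
    {μ μ' δ : Fin n → ℝ}
    (hμ : ∀ i, agreementDefect (outcomeObs (fun x => J x * J x) i)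
      (outcomeObs (fun x => G x * G x) i) v ≤ μ i)
    (hμ' : ∀ i, agreementDefect (outcomeObs (fun x => J' x * J' x) i)
      (outcomeObs (fun x => G' x * G' x) i) v ≤ μ' i)
    (hδ : ∀ i, ‖√2 • v - (α i (outcomeObs (fun x => J x * J x) i v)
      + α' i (outcomeObs (fun x => G' x * G' x) i v))‖ ^ 2 ≤ δ i) :
    ∑ x, ∑ x', ∑ y, ∑ y', ‖(J' x' * J' x') ((J x * J x) ((G y * G y) ((G' y' * G' y') v)))
        - if x = y ∧ x' = y' then
          P x x' ((J' x' * J' x') ((J x * J x) ((G y * G y) ((G' y' * G' y') v)))) else 0‖ ^ 2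
      ≤ (8 * n + 28) * (∑ i, μ i + ∑ i, μ' i) + 17 * ∑ i, δ i := by
  have sq : ∀ {f g : Module.End ℝ E}, Commute f g → Commute (f * f) (g * g) := fun h =>
    (h.mul_right h).mul_left (h.mul_right h)
  have sql : ∀ {f g : Module.End ℝ E}, Commute f g → Commute (f * f) g := fun h => h.mul_left h
  have h1 := sum_mismatch_le hJ hG hK hL hK' hL' h hJα hJα' hGα hGα' hJG
    (fun x y => (hJG' x y).mul_right (hJG' x y))
    (fun x y => (hJ'G y x).symm.mul_right (hJ'G y x).symm) (fun x y => sq (hJ'G' x y)) v hμ hμ' hδ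
  -- The same estimate with the parties and the two questions exchanged, since Charlie begins with
  -- `L'`.
  have h2 := sum_mismatch_le (δ := δ) hG' hJ' hL' hK' hL hK (fun i => (h i).swap) hG'α' hG'α hJ'α'
    hJ'α (fun x y => (hJ'G' y x).symm) (fun x y => (hJG' y x).symm.mul_right (hJG' y x).symm)
    (fun x y => (hJ'G x y).mul_right (hJ'G x y)) (fun x y => (sq (hJG y x)).symm) v
    (fun i => (agreementDefect_comm _ _ v).le.trans (hμ' i))
    (fun i => (agreementDefect_comm _ _ v).le.trans (hμ i))
    (fun i => by rw [add_comm]; exact hδ i)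
  have h3 := sum_norm_sub_projection_sq_le hK hL' h (fun x i => sql (hJα x i))
    (fun x i => sql (hJα' x i)) (fun x i => sql (hG'α x i)) (fun x i => sql (hG'α' x i))
    (fun x y => sq (hJG' x y)) hP v (μ := μ) (μ' := μ') (δ := δ)
    (fun i => (norm_sq_sub_le_agreementDefect (hL.isObservable i) v).trans
      (by linarith [hμ i]))
    (fun i => (norm_sq_sub_le_agreementDefect (hK'.isObservable i) v).trans
      (by rw [agreementDefect_comm]; linarith [hμ' i])) hδ
  have h4 := sum_norm_sub_ite_sq_le_add hL hK' (fun x y => sq (hJG x y))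
    (fun x y => sq (hJG' x y)) (fun x y => sq (hJ'G x y)) (fun z x y => sql (hJ'P z x y))
    (fun z x y => sql (hGP z x y)) v (L' := fun x => G' x * G' x)
  refine h4.trans ((add_le_add (add_le_add h1 h2) h3).trans (le_of_eq ?_))
  ring

end Measurements

/-! ### Operators acting on purified states. -/

section Action

variable {D R : Type*}

/-- The vector of a bipartite system with the given matrix of coefficients. -/
def coeffVec (M : Matrix D R ℂ) : EuclideanSpace ℂ (D × R) :=
  WithLp.toLp 2 fun p => M p.1 p.2

theorem coeffVec_surjective (v : EuclideanSpace ℂ (D × R)) :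
    v = coeffVec (Matrix.of fun d r => v (d, r)) := by
  ext p
  rfl

variable [Fintype D] [Fintype R]

theorem inner_coeffVec (M N : Matrix D R ℂ) :
    ⟪coeffVec M, coeffVec N⟫_ℝ = (Mᴴ * N).trace.re := by
  simp only [PiLp.inner_apply, Complex.inner, coeffVec, Matrix.trace, Matrix.diag_apply,
    Matrix.mul_apply, Matrix.conjTranspose_apply, Complex.re_sum, Fintype.sum_prod_type]
  rw [Finset.sum_comm]
  simp [mul_comm]

variable [DecidableEq D]

/-- The action of an operator on the first factor of a bipartite system. -/
def leftAction (D R : Type*) [Fintype D] [DecidableEq D] [Fintype R] :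
    Matrix D D ℂ →ₐ[ℝ] Module.End ℝ (EuclideanSpace ℂ (D × R)) :=
  AlgHom.ofLinearMap
    { toFun := fun X =>
        { toFun := fun v => WithLp.toLp 2 fun p => ∑ d, X p.1 d * v (d, p.2)
          map_add' := fun v w => by
            ext p
            simp [mul_add, Finset.sum_add_distrib]
          map_smul' := fun r v => by
            ext p
            simp [Finset.mul_sum, mul_left_comm] }
      map_add' := fun X Y => by
        ext v p
        simp [add_mul, Finset.sum_add_distrib]
      map_smul' := fun r X => by
        ext v p
        simp [Finset.mul_sum, mul_assoc] }
    (by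
      ext v p
      simp [Matrix.one_apply])
    (fun X Y => by
      ext v p
      simp only [LinearMap.coe_mk, AddHom.coe_mk, Matrix.mul_apply, Module.End.mul_apply,
        Finset.sum_mul, Finset.mul_sum]
      rw [Finset.sum_comm]
      simp only [mul_assoc])

theorem leftAction_apply (X : Matrix D D ℂ) (v : EuclideanSpace ℂ (D × R)) (p : D × R) :
    leftAction D R X v p = ∑ d, X p.1 d * v (d, p.2) :=
  rfl

theorem leftAction_coeffVec (X : Matrix D D ℂ) (M : Matrix D R ℂ) :
    leftAction D R X (coeffVec M) = coeffVec (X * M) := by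
  ext p
  simp [leftAction_apply, coeffVec, Matrix.mul_apply]

theorem inner_leftAction (X : Matrix D D ℂ) (v w : EuclideanSpace ℂ (D × R)) :
    ⟪leftAction D R X v, w⟫_ℝ = ⟪v, leftAction D R Xᴴ w⟫_ℝ := by
  rw [coeffVec_surjective v, coeffVec_surjective w, leftAction_coeffVec, leftAction_coeffVec,
    inner_coeffVec, inner_coeffVec, Matrix.conjTranspose_mul, Matrix.mul_assoc]

theorem leftAction_isSymmetric {X : Matrix D D ℂ} (h : X.IsHermitian) :
    (leftAction D R X).IsSymmetric := fun v w => by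
  rw [inner_leftAction, h.eq]

theorem inner_leftAction_nonneg {X : Matrix D D ℂ} (h : X.PosSemidef)
    (v : EuclideanSpace ℂ (D × R)) : 0 ≤ ⟪v, leftAction D R X v⟫_ℝ := by
  obtain ⟨Y, rfl⟩ : ∃ Y : Matrix D D ℂ, X = Yᴴ * Y := by
    open scoped MatrixOrder in
    exact CStarAlgebra.nonneg_iff_eq_star_mul_self.mp h.nonneg
  rw [map_mul, Module.End.mul_apply, ← inner_leftAction, real_inner_self_eq_norm_sq]
  positivity

theorem inner_leftAction_coeffVec (X : Matrix D D ℂ) (M : Matrix D R ℂ) :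
    ⟪coeffVec M, leftAction D R X (coeffVec M)⟫_ℝ = (X * (M * Mᴴ)).trace.re := by
  rw [leftAction_coeffVec, inner_coeffVec, Matrix.trace_mul_comm, Matrix.mul_assoc]

end Action

/-! ### Commuting operators of the three parties. -/

section Registers

variable {H K : Type*} [Fintype H] [DecidableEq H] [Fintype K] [DecidableEq K]

/-- The operators on the first of two registers. -/
def kronLeft (H K : Type*) [Fintype H] [DecidableEq H] [Fintype K] [DecidableEq K] :
    Matrix H H ℂ →ₐ[ℝ] Matrix (H × K) (H × K) ℂ :=
  AlgHom.ofLinearMap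
    { toFun := fun M => M ⊗ₖ (1 : Matrix K K ℂ)
      map_add' := fun M N => Matrix.add_kronecker M N 1
      map_smul' := fun r M => Matrix.smul_kronecker r M 1 }
    Matrix.one_kronecker_one
    (fun M N => by simp [← Matrix.mul_kronecker_mul])

/-- The operators on the second of two registers. -/
def kronRight (H K : Type*) [Fintype H] [DecidableEq H] [Fintype K] [DecidableEq K] :
    Matrix K K ℂ →ₐ[ℝ] Matrix (H × K) (H × K) ℂ :=
  AlgHom.ofLinearMap
    { toFun := fun M => (1 : Matrix H H ℂ) ⊗ₖ M
      map_add' := fun M N => Matrix.kronecker_add 1 M N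
      map_smul' := fun r M => Matrix.kronecker_smul r 1 M }
    Matrix.one_kronecker_one
    (fun M N => by simp [← Matrix.mul_kronecker_mul])

theorem kronLeft_apply (M : Matrix H H ℂ) : kronLeft H K M = M ⊗ₖ (1 : Matrix K K ℂ) := rfl

theorem kronRight_apply (M : Matrix K K ℂ) : kronRight H K M = (1 : Matrix H H ℂ) ⊗ₖ M := rfl

theorem kronLeft_mul_kronRight (M : Matrix H H ℂ) (N : Matrix K K ℂ) :
    kronLeft H K M * kronRight H K N = M ⊗ₖ N := by
  simp [kronLeft_apply, kronRight_apply, ← Matrix.mul_kronecker_mul]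

theorem kronRight_mul_kronLeft (M : Matrix H H ℂ) (N : Matrix K K ℂ) :
    kronRight H K N * kronLeft H K M = M ⊗ₖ N := by
  simp [kronLeft_apply, kronRight_apply, ← Matrix.mul_kronecker_mul]

theorem commute_kronLeft_kronRight (M : Matrix H H ℂ) (N : Matrix K K ℂ) :
    Commute (kronLeft H K M) (kronRight H K N) :=
  (kronLeft_mul_kronRight M N).trans (kronRight_mul_kronLeft M N).symm

theorem kronLeft_isHermitian {M : Matrix H H ℂ} (h : M.IsHermitian) :
    (kronLeft H K M).IsHermitian := by
  rw [Matrix.IsHermitian, kronLeft_apply, Matrix.conjTranspose_kronecker, h.eq,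
    Matrix.conjTranspose_one]

theorem kronRight_isHermitian {M : Matrix K K ℂ} (h : M.IsHermitian) :
    (kronRight H K M).IsHermitian := by
  rw [Matrix.IsHermitian, kronRight_apply, Matrix.conjTranspose_kronecker, h.eq,
    Matrix.conjTranspose_one]

end Registers

section Parties

variable {A B C R : Type*} [Fintype A] [DecidableEq A] [Fintype B] [DecidableEq B]
  [Fintype C] [DecidableEq C] [Fintype R]

variable (A B C R) in
/-- Alice's operators on a tripartite system with an environment. -/
def aliceOp : Matrix A A ℂ →ₐ[ℝ] Module.End ℝ (EuclideanSpace ℂ ((A × B × C) × R)) :=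
  (leftAction (A × B × C) R).comp (kronLeft A (B × C))

variable (A B C R) in
/-- Bob's operators on a tripartite system with an environment. -/
def bobOp : Matrix B B ℂ →ₐ[ℝ] Module.End ℝ (EuclideanSpace ℂ ((A × B × C) × R)) :=
  (leftAction (A × B × C) R).comp ((kronRight A (B × C)).comp (kronLeft B C))

variable (A B C R) in
/-- Charlie's operators on a tripartite system with an environment. -/
def charlieOp : Matrix C C ℂ →ₐ[ℝ] Module.End ℝ (EuclideanSpace ℂ ((A × B × C) × R)) :=
  (leftAction (A × B × C) R).comp ((kronRight A (B × C)).comp (kronRight B C))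

theorem commute_aliceOp_bobOp (M : Matrix A A ℂ) (N : Matrix B B ℂ) :
    Commute (aliceOp A B C R M) (bobOp A B C R N) :=
  (commute_kronLeft_kronRight M (kronLeft B C N)).map (leftAction (A × B × C) R)

theorem commute_aliceOp_charlieOp (M : Matrix A A ℂ) (N : Matrix C C ℂ) :
    Commute (aliceOp A B C R M) (charlieOp A B C R N) :=
  (commute_kronLeft_kronRight M (kronRight B C N)).map (leftAction (A × B × C) R)

theorem commute_bobOp_charlieOp (M : Matrix B B ℂ) (N : Matrix C C ℂ) :
    Commute (bobOp A B C R M) (charlieOp A B C R N) :=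
  ((commute_kronLeft_kronRight M N).map (kronRight A (B × C))).map (leftAction (A × B × C) R)

theorem aliceOp_mul_bobOp_mul_charlieOp (M : Matrix A A ℂ) (N : Matrix B B ℂ)
    (P : Matrix C C ℂ) :
    aliceOp A B C R M * (bobOp A B C R N * charlieOp A B C R P)
      = leftAction (A × B × C) R (M ⊗ₖ (N ⊗ₖ P)) := by
  simp only [aliceOp, bobOp, charlieOp, AlgHom.comp_apply, ← map_mul, kronLeft_mul_kronRight]

theorem bobOp_mul_charlieOp (N : Matrix B B ℂ) (P : Matrix C C ℂ) :
    bobOp A B C R N * charlieOp A B C R P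
      = leftAction (A × B × C) R ((1 : Matrix A A ℂ) ⊗ₖ (N ⊗ₖ P)) := by
  rw [← aliceOp_mul_bobOp_mul_charlieOp, map_one, one_mul]

theorem aliceOp_isSymmetric {M : Matrix A A ℂ} (h : M.IsHermitian) :
    (aliceOp A B C R M).IsSymmetric :=
  leftAction_isSymmetric (kronLeft_isHermitian h)

theorem bobOp_isSymmetric {M : Matrix B B ℂ} (h : M.IsHermitian) :
    (bobOp A B C R M).IsSymmetric :=
  leftAction_isSymmetric (kronRight_isHermitian (kronLeft_isHermitian h))

theorem charlieOp_isSymmetric {M : Matrix C C ℂ} (h : M.IsHermitian) :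
    (charlieOp A B C R M).IsSymmetric :=
  leftAction_isSymmetric (kronRight_isHermitian (kronRight_isHermitian h))

theorem inner_aliceOp_nonneg {M : Matrix A A ℂ} (h : M.PosSemidef)
    (v : EuclideanSpace ℂ ((A × B × C) × R)) : 0 ≤ ⟪v, aliceOp A B C R M v⟫_ℝ :=
  inner_leftAction_nonneg (h.kronecker Matrix.PosSemidef.one) v

end Parties

/-! ### Roots and outcome observables of POVMs. -/

section POVM

/-- A fourth root of a positive semidefinite operator. -/
theorem Matrix.PosSemidef.exists_fourth_root {H : Type*} [Fintype H] [DecidableEq H]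
    {M : Matrix H H ℂ} (hM : M.PosSemidef) :
    ∃ J : Matrix H H ℂ, J.IsHermitian ∧ (J * J) * (J * J) = M := by
  open scoped MatrixOrder in
  refine ⟨CFC.sqrt (CFC.sqrt M), ?_, ?_⟩
  · exact (Matrix.nonneg_iff_posSemidef.1 (CFC.sqrt_nonneg _)).isHermitian
  · rw [CFC.sqrt_mul_sqrt_self _ (CFC.sqrt_nonneg _), CFC.sqrt_mul_sqrt_self _ hM.nonneg]

variable {H : Type*} [DecidableEq H] {n : ℕ}

/-- The observable of the `i`-th outcome of a measurement. -/
def outcomeMat (P : (Fin n → Fin 2) → Matrix H H ℂ) (i : Fin n) : Matrix H H ℂ :=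
  ∑ x, outcomeSign (x i) • P x

theorem coordMeas_eq {P : (Fin n → Fin 2) → Matrix H H ℂ} (hP : IsPOVM P) (i : Fin n)
    (y : Fin 2) :
    coordMeas P i y = (1 / 2 : ℝ) • (1 + outcomeSign y • outcomeMat P i) := by
  rw [coordMeas, outcomeMat, ← hP.2, Finset.smul_sum, ← Finset.sum_add_distrib, Finset.smul_sum,
    Finset.sum_filter]
  refine Finset.sum_congr rfl fun x _ => ?_
  have h1 : x i = y ∨ x i = 1 - y := by
    generalize x i = z
    fin_cases y <;> fin_cases z <;> simp
  have h2 : outcomeSign (1 - y) = -outcomeSign y ∧ 1 - y ≠ y := by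
    fin_cases y <;> simp [outcomeSign]
  have h3 := outcomeSign_sq y
  rcases h1 with h | h
  · rw [if_pos h, h, smul_smul, h3, one_smul, ← two_smul ℝ, smul_smul]
    norm_num
  · rw [h, if_neg h2.2, h2.1, smul_smul, mul_neg, h3, neg_one_smul, add_neg_cancel, smul_zero]

variable [Fintype H]

theorem map_outcomeMat {E : Type*} [NormedAddCommGroup E] [InnerProductSpace ℝ E]
    (f : Matrix H H ℂ →ₐ[ℝ] Module.End ℝ E) {P J : (Fin n → Fin 2) → Matrix H H ℂ}
    (hJ : ∀ x, (J x * J x) * (J x * J x) = P x) (i : Fin n) :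
    outcomeObs (fun x => f (J x) * f (J x)) i = f (outcomeMat P i) := by
  simp only [outcomeObs, outcomeMat, map_sum, map_smul, ← map_mul, hJ]

theorem isKraus_map {E : Type*} [NormedAddCommGroup E] [InnerProductSpace ℝ E]
    (f : Matrix H H ℂ →ₐ[ℝ] Module.End ℝ E) {P J : (Fin n → Fin 2) → Matrix H H ℂ}
    (hP : IsPOVM P) (hJ : ∀ x, (J x * J x) * (J x * J x) = P x)
    (hJs : ∀ x, (f (J x)).IsSymmetric) :
    IsKraus fun x => f (J x) * f (J x) :=
  ⟨fun x v w => by simp only [Module.End.mul_apply]; rw [hJs, hJs], by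
    simp only [← map_mul, hJ, ← map_sum, hP.2, map_one]⟩

end POVM

/-! ### Operators at a single site of a tensor power. -/

section SiteOperators

variable {n : ℕ}

/-- The operator `M` acting at the site `i`. -/
def siteOp {H : Type*} [DecidableEq H] (i : Fin n) (M : Matrix H H ℂ) :
    Matrix (Fin n → H) (Fin n → H) ℂ :=
  tensorOp (Function.update (fun _ => 1) i M)

variable {H : Type*} [DecidableEq H]

theorem siteOp_apply (i : Fin n) (M : Matrix H H ℂ) (a b : Fin n → H) :
    siteOp i M a b
      = M (a i) (b i) * ∏ j ∈ Finset.univ.erase i, (1 : Matrix H H ℂ) (a j) (b j) := by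
  rw [siteOp, tensorOp, Matrix.of_apply, ← Finset.mul_prod_erase _ _ (Finset.mem_univ i),
    Function.update_self]
  congr 1
  refine Finset.prod_congr rfl fun j hj => ?_
  rw [Function.update_of_ne (Finset.ne_of_mem_erase hj)]

theorem siteOp_neg (i : Fin n) (M : Matrix H H ℂ) : siteOp i (-M) = -siteOp i M := by
  ext a b
  simp [siteOp_apply]

theorem siteOp_add (i : Fin n) (M N : Matrix H H ℂ) :
    siteOp i (M + N) = siteOp i M + siteOp i N := by
  ext a b
  simp [siteOp_apply, add_mul]

theorem siteOp_smul (i : Fin n) (r : ℝ) (M : Matrix H H ℂ) :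
    siteOp i (r • M) = r • siteOp i M := by
  ext a b
  simp [siteOp_apply, mul_assoc]

theorem siteOp_isHermitian (i : Fin n) {M : Matrix H H ℂ} (h : M.IsHermitian) :
    (siteOp i M).IsHermitian := by
  ext a b
  rw [Matrix.conjTranspose_apply, siteOp_apply, siteOp_apply, star_mul', h.apply, star_prod]
  congr 1
  exact Finset.prod_congr rfl fun j _ => Matrix.isHermitian_one.apply _ _

theorem siteOp_one (i : Fin n) : siteOp i (1 : Matrix H H ℂ) = 1 := by
  have h1 : siteOp i (1 : Matrix H H ℂ) = tensorOp fun _ : Fin n => 1 := by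
    rw [siteOp]
    congr 1
    exact Function.update_eq_self i fun _ => (1 : Matrix H H ℂ)
  rw [h1]
  ext a b
  rw [tensorOp, Matrix.of_apply]
  by_cases h : a = b
  · subst h
    simp
  · obtain ⟨j, hj⟩ := Function.ne_iff.1 h
    rw [Matrix.one_apply_ne h]
    exact Finset.prod_eq_zero (Finset.mem_univ j) (Matrix.one_apply_ne hj)

/-- Distributing the sum over strings into a product over sites, every site but `i` sums to the
identity and only `i` carries the sign. -/
theorem outcomeMat_tensorOp {Q : Fin n → Fin 2 → Matrix H H ℂ} (hQ : ∀ i, ∑ y, Q i y = 1)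
    (i : Fin n) :
    outcomeMat (fun x => tensorOp fun j => Q j (x j)) i = siteOp i (Q i 0 - Q i 1) := by
  ext a b
  have h1 : ∀ x : Fin n → Fin 2, outcomeSign (x i) * ∏ j, Q j (x j) (a j) (b j)
      = ∏ j, ((if j = i then (outcomeSign (x j) : ℂ) else 1) * Q j (x j) (a j) (b j)) :=
    fun x => by
      rw [Finset.prod_mul_distrib, Finset.prod_ite_eq' Finset.univ i, if_pos (Finset.mem_univ i)]
  have h2 : ∑ x : Fin n → Fin 2, outcomeSign (x i) * ∏ j, Q j (x j) (a j) (b j)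
      = ∏ j, ∑ y, ((if j = i then (outcomeSign y : ℂ) else 1) * Q j y (a j) (b j)) := by
    rw [Finset.prod_univ_sum]
    simp [h1]
  simp only [outcomeMat, Matrix.sum_apply, Matrix.smul_apply, tensorOp, Matrix.of_apply,
    Complex.real_smul]
  rw [h2, siteOp_apply, ← Finset.mul_prod_erase _ _ (Finset.mem_univ i)]
  congr 1
  · simp [outcomeSign, sub_eq_add_neg]
  · refine Finset.prod_congr rfl fun j hj => ?_
    rw [← hQ j, Matrix.sum_apply]
    simp [Finset.ne_of_mem_erase hj]

variable [Fintype H]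

theorem siteOp_mul (i : Fin n) (M N : Matrix H H ℂ) :
    siteOp i M * siteOp i N = siteOp i (M * N) := by
  rw [siteOp, siteOp, siteOp, ← tensorOp_mul]
  congr 1
  funext j
  by_cases h : j = i
  · subst h
    simp
  · simp [Function.update_of_ne h]

end SiteOperators

/-! ### Pauli observables and Wiesner-Breidbart projections. -/

section Qubits

theorem sqrt_two_mul_self_complex : ((√2 : ℝ) : ℂ) * ((√2 : ℝ) : ℂ) = 2 := by
  rw [← Complex.ofReal_mul, Real.mul_self_sqrt (by norm_num)]
  norm_num

theorem cos_sq_pi_div_eight : Real.cos (Real.pi / 8) ^ 2 = 1 / 2 + √2 / 4 := by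
  rw [Real.cos_sq, show 2 * (Real.pi / 8) = Real.pi / 4 by ring, Real.cos_pi_div_four]
  ring

theorem sin_sq_pi_div_eight : Real.sin (Real.pi / 8) ^ 2 = 1 / 2 - √2 / 4 := by
  rw [Real.sin_sq, cos_sq_pi_div_eight]
  ring

theorem cos_mul_sin_pi_div_eight :
    Real.cos (Real.pi / 8) * Real.sin (Real.pi / 8) = √2 / 4 := by
  have h := Real.sin_two_mul (Real.pi / 8)
  rw [show 2 * (Real.pi / 8) = Real.pi / 4 by ring, Real.sin_pi_div_four] at h
  linarith

/-- Alice's observable for the question `θ`. -/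
def questionPauli (θ : Fin 2) : Matrix (Fin 2) (Fin 2) ℂ := if θ = 0 then pauliZ else pauliX

theorem questionPauli_isHermitian (θ : Fin 2) : (questionPauli θ).IsHermitian := by
  ext i j
  fin_cases θ <;> fin_cases i <;> fin_cases j <;> simp [questionPauli, pauliX, pauliZ]

theorem questionPauli_sq (θ : Fin 2) : questionPauli θ * questionPauli θ = 1 := by
  ext i j
  fin_cases θ <;> fin_cases i <;> fin_cases j <;>
    simp [questionPauli, pauliX, pauliZ]

theorem questionPauli_anti (θ : Fin 2) :
    questionPauli θ * questionPauli (θ + 1) = -(questionPauli (θ + 1) * questionPauli θ) := by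
  ext i j
  fin_cases θ <;> fin_cases i <;> fin_cases j <;>
    simp [questionPauli, pauliX, pauliZ]

theorem ketbra_conjugateCodingKet_sub (θ : Fin 2) :
    ketbra (conjugateCodingKet θ 0) - ketbra (conjugateCodingKet θ 1) = questionPauli θ := by
  have h2 : ((Real.sqrt 2 : ℝ) : ℂ)⁻¹ * ((Real.sqrt 2 : ℝ) : ℂ)⁻¹ = 2⁻¹ := by
    rw [← mul_inv, sqrt_two_mul_self_complex]
  ext i j
  fin_cases θ <;> fin_cases i <;> fin_cases j <;>
    simp [ketbra, conjugateCodingKet, qubitKet, hadamardOp, Matrix.vecMulVec_apply,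
      questionPauli, pauliX, pauliZ, h2] <;> norm_num

/-- The Breidbart state points halfway between `Z` and `X` on the Bloch sphere; conjugation by `X`
flips the sign of `Z` and conversely. Thus `s 0` is the outcome guessed for `Z` and `s 1` that for
`X`. -/
theorem ketbra_wiesnerBreidbart (s : Fin 2 → Fin 2) :
    ketbra (wiesnerBreidbart s) = (1 / 2 : ℝ) • (1 + (√2 / 2) •
      (outcomeSign (s 0) • pauliZ + outcomeSign (s 1) • pauliX)) := by
  have hc : (Real.cos (Real.pi / 8) : ℂ) * Real.cos (Real.pi / 8) = 1 / 2 + (√2 : ℝ) / 4 := by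
    rw [← Complex.ofReal_mul, ← sq, cos_sq_pi_div_eight]
    push_cast
    ring
  have hs : (Real.sin (Real.pi / 8) : ℂ) * Real.sin (Real.pi / 8) = 1 / 2 - (√2 : ℝ) / 4 := by
    rw [← Complex.ofReal_mul, ← sq, sin_sq_pi_div_eight]
    push_cast
    ring
  have hcs : (Real.cos (Real.pi / 8) : ℂ) * Real.sin (Real.pi / 8) = (√2 : ℝ) / 4 := by
    rw [← Complex.ofReal_mul, cos_mul_sin_pi_div_eight]
    push_cast
    ring
  have hsc : (Real.sin (Real.pi / 8) : ℂ) * Real.cos (Real.pi / 8) = (√2 : ℝ) / 4 := by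
    rw [mul_comm, hcs]
  rw [wiesnerBreidbart, breidbartState, breidbartOp]
  generalize hC : (Real.cos (Real.pi / 8) : ℂ) = c at *
  generalize hS : (Real.sin (Real.pi / 8) : ℂ) = d at *
  have hc' : (starRingEnd ℂ) c = c := by rw [← hC, Complex.conj_ofReal]
  have hd' : (starRingEnd ℂ) d = d := by rw [← hS, Complex.conj_ofReal]
  have hb : !![c, d; d, -c] *ᵥ qubitKet 0 = ![c, d] := by
    ext i
    fin_cases i <;> simp [qubitKet]
  rw [hb]
  generalize s 0 = p
  generalize s 1 = q
  ext i j
  fin_cases p <;> fin_cases q <;> fin_cases i <;> fin_cases j <;>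
  simp [ketbra, hc', hd', Matrix.vecMulVec_apply, pauliX, pauliZ, outcomeSign, hc, hs,
    hcs, hsc] <;> ring

end Qubits

/-! ### Flipped questions, choice of a question, and labels. -/

section Questions

variable {n : ℕ}

/-- The question that differs from `θ` at the site `i` only. -/
def flipAt (θ : Fin n → Fin 2) (i : Fin n) : Fin n → Fin 2 := Function.update θ i (θ i + 1)

theorem fin_two_add_one_add_one (s : Fin 2) : s + 1 + 1 = s := by
  fin_cases s <;> rfl

theorem flipAt_self (θ : Fin n → Fin 2) (i : Fin n) : flipAt θ i i = θ i + 1 :=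
  Function.update_self _ _ _

theorem flipAt_involutive (i : Fin n) : Function.Involutive fun θ : Fin n → Fin 2 => flipAt θ i :=
  fun θ => by
    simp [flipAt, fin_two_add_one_add_one]

/-- The question that differs from `θ` at every site. -/
def flipAll (θ : Fin n → Fin 2) : Fin n → Fin 2 := fun i => θ i + 1

theorem flipAll_involutive : Function.Involutive (flipAll (n := n)) := fun θ => by
  funext i
  exact fin_two_add_one_add_one _

/-- The defect of the rounds with questions `θ` and `flipAt θ i`, in terms of the winning
probabilities. -/
def siteDefect (κ : ℝ) (w : (Fin n → Fin 2) → Fin n → ℝ) (θ : Fin n → Fin 2) (i : Fin n) : ℝ :=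
  2 * κ - w θ i - w (flipAt θ i) i

/-- Flipping one site or all sites permutes the questions, so each of the two defects averages to at
most `2 * ε` at every site; some question does no worse than the average of the sum over sites. -/
theorem exists_sum_siteDefect_le {κ ε : ℝ} {w : (Fin n → Fin 2) → Fin n → ℝ}
    (hw : ∀ i, κ - ε ≤ (1 / 2) ^ n * ∑ θ, w θ i) :
    ∃ θ, ∑ i, (siteDefect κ w θ i + siteDefect κ w (flipAll θ) i) ≤ 4 * n * ε := by
  have h1 : ∀ i, ∑ θ, siteDefect κ w θ i ≤ 2 ^ n * (2 * ε) := fun i => by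
    have h2 : ∑ θ, w (flipAt θ i) i = ∑ θ, w θ i :=
      Equiv.sum_comp (flipAt_involutive i).toPerm fun θ => w θ i
    have h3 : (2 : ℝ) ^ n * (1 / 2) ^ n = 1 := by rw [← mul_pow]; norm_num
    have h4 := mul_le_mul_of_nonneg_left (hw i) (show (0 : ℝ) ≤ 2 ^ n by positivity)
    rw [← mul_assoc, h3, one_mul] at h4
    simp only [siteDefect, Finset.sum_sub_distrib, h2, Finset.sum_const, Finset.card_univ,
      Fintype.card_fun, Fintype.card_fin, nsmul_eq_mul, Nat.cast_pow, Nat.cast_ofNat]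
    linarith
  have h5 : ∀ i, ∑ θ, siteDefect κ w (flipAll θ) i ≤ 2 ^ n * (2 * ε) := fun i =>
    (Equiv.sum_comp flipAll_involutive.toPerm fun θ => siteDefect κ w θ i).le.trans (h1 i)
  by_contra! h
  have h6 : ∑ θ : Fin n → Fin 2, 4 * n * ε
      < ∑ θ, ∑ i, (siteDefect κ w θ i + siteDefect κ w (flipAll θ) i) :=
    Finset.sum_lt_sum_of_nonempty Finset.univ_nonempty fun θ _ => h θ
  rw [Finset.sum_comm] at h6
  have h7 : ∑ i, ∑ θ, (siteDefect κ w θ i + siteDefect κ w (flipAll θ) i)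
      ≤ ∑ _i : Fin n, 2 ^ n * (4 * ε) := Finset.sum_le_sum fun i _ => by
    rw [Finset.sum_add_distrib]
    linarith [h1 i, h5 i]
  have h8 := h6.trans_le h7
  simp only [Finset.sum_const, Finset.card_univ, Fintype.card_fun, Fintype.card_fin,
    nsmul_eq_mul, Nat.cast_pow, Nat.cast_ofNat] at h8
  linarith

/-- The labels for which the outcomes are `x` on the question `θ` and `y` on its complement. -/
def labelOf (θ x y : Fin n → Fin 2) : Fin n → Fin 2 → Fin 2 :=
  fun i j => if j = θ i then x i else y i

/-- Labels are pairs of outcomes, for a question and for its complement. -/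
def labelEquiv (θ : Fin n → Fin 2) :
    (Fin n → Fin 2 → Fin 2) ≃ (Fin n → Fin 2) × (Fin n → Fin 2) where
  toFun t := (fun i => t i (θ i), fun i => t i (θ i + 1))
  invFun p := labelOf θ p.1 p.2
  left_inv t := by
    funext i j
    simp only [labelOf]
    split_ifs with h
    · rw [h]
    · congr 1
      generalize θ i = s at h ⊢
      fin_cases s <;> fin_cases j <;> simp_all
  right_inv p := by
    have h : ∀ s : Fin 2, s + 1 ≠ s := by decide
    ext i <;> simp [labelOf, h]

end Questions

/-! ### Winning probabilities and defects. -/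

section WinningProbability

variable {E : Type*} [NormedAddCommGroup E] [InnerProductSpace ℝ E]

/-- The probability that three commuting observables have equal outcomes. -/
def winProb (a b c : Module.End ℝ E) (v : E) : ℝ :=
  (1 / 4) * (‖v‖ ^ 2 + ⟪v, a (b v)⟫_ℝ + ⟪v, a (c v)⟫_ℝ + ⟪v, b (c v)⟫_ℝ)

theorem sum_inner_eq_winProb (a b c : Module.End ℝ E) (v : E) :
    ∑ y : Fin 2, ⟪v, (((1 / 2 : ℝ) • (1 + outcomeSign y • a)) *
      (((1 / 2 : ℝ) • (1 + outcomeSign y • b)) * ((1 / 2 : ℝ) • (1 + outcomeSign y • c)))) v⟫_ℝ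
      = winProb a b c v := by
  simp [Fin.sum_univ_two, outcomeSign, winProb, inner_add_right, real_inner_smul_right]
  ring

/-- The six correlations in the two winning probabilities are regrouped crosswise, Bob's operator
for one question with Charlie's for the other. -/
theorem roundDefect_eq {a a' b b' c c' : Module.End ℝ E} (hb : b.IsSymmetric)
    (hb' : b'.IsSymmetric) {v : E} (hv : ‖v‖ = 1) :
    roundDefect a a' b b' c c' v
      = 4 * (2 * Real.cos (Real.pi / 8) ^ 2 - winProb a b c v - winProb a' b' c' v) := by
  rw [cos_sq_pi_div_eight, roundDefect, pairDefect, pairDefect, agreementDefect, agreementDefect,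
    winProb, winProb, hb, hb', hv, inner_add_right, inner_add_right]
  ring

end WinningProbability

/-! ### Alice's observables and the projection onto a labelled state. -/

section Alice

variable {n : ℕ} {B C R : Type*} [Fintype B] [DecidableEq B] [Fintype C] [DecidableEq C]
  [Fintype R]

theorem outcomeMat_tfkw (θ : Fin n → Fin 2) (i : Fin n) :
    outcomeMat ((tfkwGame.parallel n).meas θ) i = siteOp i (questionPauli (θ i)) := by
  rw [← ketbra_conjugateCodingKet_sub]
  exact outcomeMat_tensorOp (Q := fun i y => ketbra (conjugateCodingKet (θ i) y))
    (fun i => (conjugateCoding_isPOVM (θ i)).2) i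

variable (B C R) in
/-- Alice's observable at the site `i` for the question `s`. -/
def aliceObs (i : Fin n) (s : Fin 2) :
    Module.End ℝ (EuclideanSpace ℂ (((Fin n → Fin 2) × B × C) × R)) :=
  aliceOp _ B C R (siteOp i (questionPauli s))

theorem aliceObs_pair (i : Fin n) (s : Fin 2) :
    AnticommutingPair (aliceObs B C R i s) (aliceObs B C R i (s + 1)) where
  symm := aliceOp_isSymmetric (siteOp_isHermitian i (questionPauli_isHermitian s))
  symm' := aliceOp_isSymmetric (siteOp_isHermitian i (questionPauli_isHermitian _))
  sq := by rw [aliceObs, ← map_mul, siteOp_mul, questionPauli_sq, siteOp_one, map_one]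
  sq' := by rw [aliceObs, ← map_mul, siteOp_mul, questionPauli_sq, siteOp_one, map_one]
  anti := by
    rw [aliceObs, aliceObs, ← map_mul, ← map_mul, siteOp_mul, siteOp_mul, questionPauli_anti,
      siteOp_neg, map_neg]

/-- The projection onto the Wiesner-Breidbart state with labels `t`. -/
def labelProj (t : Fin n → Fin 2 → Fin 2) : Matrix (Fin n → Fin 2) (Fin n → Fin 2) ℂ :=
  tensorOp fun i => ketbra (wiesnerBreidbart (t i))

theorem ketbra_isHermitian {H : Type*} (v : H → ℂ) : (ketbra v).IsHermitian := by
  ext i j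
  simp [ketbra, Matrix.vecMulVec_apply, mul_comm]

theorem ketbra_wiesnerBreidbart_mul_self (s : Fin 2 → Fin 2) :
    ketbra (wiesnerBreidbart s) * ketbra (wiesnerBreidbart s) = ketbra (wiesnerBreidbart s) := by
  have h2 := sqrt_two_mul_self_complex
  rw [ketbra_wiesnerBreidbart]
  generalize s 0 = p
  generalize s 1 = q
  ext i j
  fin_cases p <;> fin_cases q <;> fin_cases i <;> fin_cases j <;>
  simp [Matrix.mul_apply, Fin.sum_univ_two, pauliX, pauliZ, outcomeSign] <;>
  first | ring1 | linear_combination (1 / 8 : ℂ) * h2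

theorem posSemidef_of_isHermitian_of_mul_self {H : Type*} [Fintype H] {P : Matrix H H ℂ}
    (h : P.IsHermitian) (h' : P * P = P) : P.PosSemidef := by
  rw [← h']
  nth_rewrite 1 [← h.eq]
  exact Matrix.posSemidef_conjTranspose_mul_self P

theorem labelProj_mul_self (t : Fin n → Fin 2 → Fin 2) :
    labelProj t * labelProj t = labelProj t := by
  rw [labelProj, ← tensorOp_mul]
  simp only [ketbra_wiesnerBreidbart_mul_self]

theorem labelProj_isHermitian (t : Fin n → Fin 2 → Fin 2) : (labelProj t).IsHermitian :=
  (tensorOp_posSemidef fun i => posSemidef_of_isHermitian_of_mul_self (ketbra_isHermitian _)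
    (ketbra_wiesnerBreidbart_mul_self (t i))).isHermitian

/-- A union bound over sites: one minus a product of single-site projections is at most the sum of
their complements. -/
theorem norm_sub_labelProj_sq_le (t : Fin n → Fin 2 → Fin 2)
    (w : EuclideanSpace ℂ (((Fin n → Fin 2) × B × C) × R)) :
    ‖w - aliceOp _ B C R (labelProj t) w‖ ^ 2 ≤ ∑ i, (1 / 2) * (‖w‖ ^ 2 - √2 / 2 *
      (outcomeSign (t i 0) * ⟪w, aliceObs B C R i 0 w⟫_ℝ
        + outcomeSign (t i 1) * ⟪w, aliceObs B C R i 1 w⟫_ℝ)) := by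
  -- Outcome `0` at a site means success there, so the all-zero string is the wanted projection and
  -- every other string is a failure.
  set Q : Fin n → Fin 2 → Matrix (Fin 2) (Fin 2) ℂ := fun i y =>
    if y = 0 then ketbra (wiesnerBreidbart (t i)) else 1 - ketbra (wiesnerBreidbart (t i)) with hQ
  have hQp : ∀ i, IsPOVM (Q i) := fun i => by
    have h1 := ketbra_isHermitian (wiesnerBreidbart (t i))
    have h2 := ketbra_wiesnerBreidbart_mul_self (t i)
    refine ⟨fun y => ?_, ?_⟩
    · simp only [hQ]
      split_ifs
      · exact posSemidef_of_isHermitian_of_mul_self h1 h2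
      · refine posSemidef_of_isHermitian_of_mul_self (Matrix.isHermitian_one.sub h1) ?_
        simp [sub_mul, mul_sub, h2]
    · simp [hQ, Fin.sum_univ_two]
  have hT := tensorOp_isPOVM hQp
  set T : (Fin n → Fin 2) → Matrix (Fin n → Fin 2) (Fin n → Fin 2) ℂ :=
    fun z => tensorOp fun i => Q i (z i) with hTd
  have hT0 : T 0 = labelProj t := by simp [hTd, hQ, labelProj]
  have h1 : ‖w - aliceOp _ B C R (labelProj t) w‖ ^ 2
      = ‖w‖ ^ 2 - ⟪w, aliceOp _ B C R (labelProj t) w⟫_ℝ := by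
    have h2 : ‖aliceOp _ B C R (labelProj t) w‖ ^ 2 = ⟪w, aliceOp _ B C R (labelProj t) w⟫_ℝ := by
      rw [← real_inner_self_eq_norm_sq, aliceOp_isSymmetric (labelProj_isHermitian t),
        ← Module.End.mul_apply, ← map_mul, labelProj_mul_self]
    rw [norm_sub_sq_real, h2]
    ring
  have hsum : ∑ z, ⟪w, aliceOp _ B C R (T z) w⟫_ℝ = ‖w‖ ^ 2 := by
    rw [← inner_sum, ← LinearMap.sum_apply, ← map_sum, hT.2, map_one, Module.End.one_apply,
      real_inner_self_eq_norm_sq]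
  have h3 : ‖w - aliceOp _ B C R (labelProj t) w‖ ^ 2
      = ∑ z, (if z ≠ 0 then 1 else 0) * ⟪w, aliceOp _ B C R (T z) w⟫_ℝ := by
    have h2 : ∀ z, (if z ≠ 0 then (1 : ℝ) else 0) * ⟪w, aliceOp _ B C R (T z) w⟫_ℝ
        = ⟪w, aliceOp _ B C R (T z) w⟫_ℝ
          - if z = 0 then ⟪w, aliceOp _ B C R (T z) w⟫_ℝ else 0 := fun z => by
      by_cases hz : z = 0 <;> simp [hz]
    simp only [h2, Finset.sum_sub_distrib, Finset.sum_ite_eq', Finset.mem_univ, if_true, hsum, hT0,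
      h1]
  have h4 : ∀ i, (1 / 2) * (‖w‖ ^ 2 - √2 / 2 *
      (outcomeSign (t i 0) * ⟪w, aliceObs B C R i 0 w⟫_ℝ
        + outcomeSign (t i 1) * ⟪w, aliceObs B C R i 1 w⟫_ℝ))
      = ∑ z, (1 / 2) * (1 - outcomeSign (z i) * outcomeSign ((0 : Fin n → Fin 2) i))
        * ⟪w, aliceOp _ B C R (T z) w⟫_ℝ := fun i => by
    have h5 : outcomeMat T i = (√2 / 2) • (outcomeSign (t i 0) • siteOp i (questionPauli 0)
        + outcomeSign (t i 1) • siteOp i (questionPauli 1)) := by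
      rw [hTd, outcomeMat_tensorOp fun i => (hQp i).2]
      simp only [← siteOp_smul, ← siteOp_add]
      congr 1
      simp only [hQ, if_true, one_ne_zero, if_false, ketbra_wiesnerBreidbart, questionPauli]
      module
    have h6 : ∑ z, outcomeSign (z i) * ⟪w, aliceOp _ B C R (T z) w⟫_ℝ
        = √2 / 2 * (outcomeSign (t i 0) * ⟪w, aliceObs B C R i 0 w⟫_ℝ
        + outcomeSign (t i 1) * ⟪w, aliceObs B C R i 1 w⟫_ℝ) := by
      have h7 := congrArg (fun M => ⟪w, aliceOp _ B C R M w⟫_ℝ) h5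
      simpa only [outcomeMat, map_sum, map_smul, LinearMap.sum_apply, LinearMap.smul_apply,
        inner_sum, real_inner_smul_right, map_add, LinearMap.add_apply, inner_add_right,
        aliceObs] using h7
    rw [← h6, ← hsum, ← Finset.sum_sub_distrib, Finset.mul_sum]
    refine Finset.sum_congr rfl fun z _ => ?_
    simp only [outcomeSign, Pi.zero_apply, Fin.val_zero, pow_zero]
    ring
  rw [h3, Finset.sum_congr rfl fun i _ => h4 i, Finset.sum_comm]
  refine Finset.sum_le_sum fun z _ => ?_
  rw [← Finset.sum_mul]
  exact mul_le_mul_of_nonneg_right (ite_ne_le_sum_sign z 0) (inner_aliceOp_nonneg (hT.1 z) w)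

end Alice

/-! ### The estimate for a given strategy. -/

section Strategies

variable {n : ℕ} {B C R : Type*} [Fintype B] [DecidableEq B] [Fintype C] [DecidableEq C]
  [Fintype R]

theorem coordWinProb_eq (S : MoEStrategy (Fin n → Fin 2) (Fin n → Fin 2) (Fin n → Fin 2) B C)
    {M : Matrix ((Fin n → Fin 2) × B × C) R ℂ} (hM : S.state = M * Mᴴ) (i : Fin n) :
    tfkwGame.coordWinProb S i = (1 / 2) ^ n * ∑ θ, winProb (aliceObs B C R i (θ i))
      (bobOp _ B C R (outcomeMat (S.bob θ) i)) (charlieOp _ B C R (outcomeMat (S.charlie θ) i))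
      (coeffVec M) := by
  rw [MoEGame.coordWinProb, Finset.mul_sum]
  refine Finset.sum_congr rfl fun θ _ => ?_
  have h1 : (tfkwGame.parallel n).prob θ = (1 / 2) ^ n := by
    simp [MoEGame.parallel, tfkwGame]
  rw [h1, ← sum_inner_eq_winProb]
  refine congrArg _ (Finset.sum_congr rfl fun y _ => ?_)
  rw [hM, ← inner_leftAction_coeffVec, ← aliceOp_mul_bobOp_mul_charlieOp,
    coordMeas_eq ((tfkwGame.parallel n).meas_povm θ), coordMeas_eq (S.bob_povm θ),
    coordMeas_eq (S.charlie_povm θ), outcomeMat_tfkw]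
  simp only [map_smul, map_add, map_one, aliceObs]

theorem norm_coeffVec_eq_one {D : Type*} [Fintype D] {ρ : Matrix D D ℂ} {M : Matrix D R ℂ}
    (hM : ρ = M * Mᴴ) (hρ : ρ.trace = 1) : ‖coeffVec M‖ = 1 := by
  have h : ‖coeffVec M‖ ^ 2 = 1 := by
    rw [← real_inner_self_eq_norm_sq, inner_coeffVec, Matrix.trace_mul_comm, ← hM, hρ,
      Complex.one_re]
  exact (pow_eq_one_iff_of_nonneg (norm_nonneg _) two_ne_zero).1 h

theorem pairDefect_swap {E : Type*} [NormedAddCommGroup E] [InnerProductSpace ℝ E]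
    (a a' b c : Module.End ℝ E) (v : E) : pairDefect a a' b c v = pairDefect a' a c b v := by
  rw [pairDefect, pairDefect, add_comm]

theorem roundDefect_swap {E : Type*} [NormedAddCommGroup E] [InnerProductSpace ℝ E]
    (a a' b b' c c' : Module.End ℝ E) (v : E) :
    roundDefect a a' b b' c c' v = roundDefect a' a b' b c' c v := by
  rw [roundDefect, roundDefect, pairDefect_swap, pairDefect_swap a a' c b']
  ring

theorem IsRound.swap {E : Type*} [NormedAddCommGroup E] [InnerProductSpace ℝ E]
    {a a' b b' c c' : Module.End ℝ E} (h : IsRound a a' b b' c c') : IsRound a' a b' b c' c :=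
  ⟨h.pair.swap, h.obs_b', h.obs_b, h.obs_c', h.obs_c, h.a'b', h.a'b, h.a'c', h.a'c, h.ab', h.ab,
    h.ac', h.ac, h.b'c', h.b'c, h.bc', h.bc⟩

/-- Hermitian operators whose squares sum to one. -/
def IsKrausMat {X H : Type*} [Fintype X] [Fintype H] [DecidableEq H]
    (K : X → Matrix H H ℂ) : Prop :=
  (∀ x, (K x).IsHermitian) ∧ ∑ x, K x * K x = 1

theorem isKrausMat_of_fourth_root {X H : Type*} [Fintype X] [Fintype H] [DecidableEq H]
    {P J : X → Matrix H H ℂ} (hP : IsPOVM P) (hJ : ∀ x, (J x).IsHermitian)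
    (hJP : ∀ x, (J x * J x) * (J x * J x) = P x) : IsKrausMat fun x => J x * J x :=
  ⟨fun x => by rw [Matrix.IsHermitian, Matrix.conjTranspose_mul, (hJ x).eq], by
    simp only [hJP, hP.2]⟩

/-- Measurements of Bob and Charlie on a question and its complement, in opposite orders, after
which the state is close to a combination of Wiesner-Breidbart states. -/
theorem exists_isKrausMat (hn : 1 ≤ n)
    (S : MoEStrategy (Fin n → Fin 2) (Fin n → Fin 2) (Fin n → Fin 2) B C)
    {M : Matrix ((Fin n → Fin 2) × B × C) R ℂ} (hM : S.state = M * Mᴴ) {ε : ℝ} (hε : 0 ≤ ε)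
    (hS : ∀ i, Real.cos (Real.pi / 8) ^ 2 - ε ≤ tfkwGame.coordWinProb S i) :
    ∃ (θ : Fin n → Fin 2) (K K' : (Fin n → Fin 2) → Matrix B B ℂ)
      (L L' : (Fin n → Fin 2) → Matrix C C ℂ),
      IsKrausMat K ∧ IsKrausMat K' ∧ IsKrausMat L ∧ IsKrausMat L' ∧
      ∑ x, ∑ x', ∑ y, ∑ y', ‖leftAction _ R ((1 : Matrix (Fin n → Fin 2) (Fin n → Fin 2) ℂ)
          ⊗ₖ ((K' x' * K x) ⊗ₖ (L y * L' y'))) (coeffVec M)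
        - if x = y ∧ x' = y' then aliceOp _ B C R (labelProj (labelOf θ x x'))
            (leftAction _ R ((1 : Matrix (Fin n → Fin 2) (Fin n → Fin 2) ℂ)
              ⊗ₖ ((K' x' * K x) ⊗ₖ (L y * L' y'))) (coeffVec M)) else 0‖ ^ 2
      ≤ (100 * n * √ε) ^ 2 := by
  choose Jb hJb hJb4 using fun θ x => ((S.bob_povm θ).1 x).exists_fourth_root
  choose Jc hJc hJc4 using fun θ x => ((S.charlie_povm θ).1 x).exists_fourth_root
  set v := coeffVec M with hv
  have hv1 : ‖v‖ = 1 := norm_coeffVec_eq_one hM S.state_density.2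
  set fB := bobOp (Fin n → Fin 2) B C R
  set fC := charlieOp (Fin n → Fin 2) B C R
  have hKb : ∀ θ, IsKraus fun x => fB (Jb θ x) * fB (Jb θ x) := fun θ =>
    isKraus_map fB (S.bob_povm θ) (hJb4 θ) fun x => bobOp_isSymmetric (hJb θ x)
  have hKc : ∀ θ, IsKraus fun x => fC (Jc θ x) * fC (Jc θ x) := fun θ =>
    isKraus_map fC (S.charlie_povm θ) (hJc4 θ) fun x => charlieOp_isSymmetric (hJc θ x)
  have hb : ∀ θ i, outcomeObs (fun x => fB (Jb θ x) * fB (Jb θ x)) i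
      = fB (outcomeMat (S.bob θ) i) := fun θ i => map_outcomeMat fB (hJb4 θ) i
  have hc : ∀ θ i, outcomeObs (fun x => fC (Jc θ x) * fC (Jc θ x)) i
      = fC (outcomeMat (S.charlie θ) i) := fun θ i => map_outcomeMat fC (hJc4 θ) i
  set b := fun θ i => fB (outcomeMat (S.bob θ) i) with hbd
  set c := fun θ i => fC (outcomeMat (S.charlie θ) i) with hcd
  have hbo : ∀ θ i, IsObservable (b θ i) := fun θ i => by
    have h := (hKb θ).isObservable i
    rwa [hb] at h
  have hco : ∀ θ i, IsObservable (c θ i) := fun θ i => by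
    have h := (hKc θ).isObservable i
    rwa [hc] at h
  have hAB : ∀ N P, Commute (aliceOp (Fin n → Fin 2) B C R N) (fB P) := commute_aliceOp_bobOp
  have hAC : ∀ N P, Commute (aliceOp (Fin n → Fin 2) B C R N) (fC P) := commute_aliceOp_charlieOp
  have hBC : ∀ N P, Commute (fB N) (fC P) := commute_bobOp_charlieOp
  have hround : ∀ θ i, IsRound (aliceObs B C R i (θ i)) (aliceObs B C R i (θ i + 1))
      (b θ i) (b (flipAt θ i) i) (c θ i) (c (flipAt θ i) i) := fun θ i =>
    ⟨aliceObs_pair i _, hbo _ _, hbo _ _, hco _ _, hco _ _, hAB _ _, hAB _ _, hAC _ _, hAC _ _,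
      hAB _ _, hAB _ _, hAC _ _, hAC _ _, hBC _ _, hBC _ _, hBC _ _, hBC _ _⟩
  set w := fun (θ : Fin n → Fin 2) i => winProb (aliceObs B C R i (θ i)) (b θ i) (c θ i) v with hw
  set D := fun θ i => roundDefect (aliceObs B C R i (θ i)) (aliceObs B C R i (θ i + 1))
      (b θ i) (b (flipAt θ i) i) (c θ i) (c (flipAt θ i) i) v with hD
  have hDw : ∀ θ i, D θ i = 4 * siteDefect (Real.cos (Real.pi / 8) ^ 2) w θ i := fun θ i => by
    simp only [hD, roundDefect_eq (hbo _ _).symm (hbo _ _).symm hv1, siteDefect, hw, flipAt_self]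
  obtain ⟨θ, hθ⟩ := exists_sum_siteDefect_le (κ := Real.cos (Real.pi / 8) ^ 2) (ε := ε) (w := w)
    fun i => (hS i).trans (coordWinProb_eq S hM i).le
  refine ⟨θ, fun x => Jb θ x * Jb θ x, fun x => Jb (flipAll θ) x * Jb (flipAll θ) x,
    fun x => Jc θ x * Jc θ x, fun x => Jc (flipAll θ) x * Jc (flipAll θ) x, ?_, ?_, ?_, ?_, ?_⟩
  · exact isKrausMat_of_fourth_root (S.bob_povm _) (hJb _) (hJb4 _)
  · exact isKrausMat_of_fourth_root (S.bob_povm _) (hJb _) (hJb4 _)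
  · exact isKrausMat_of_fourth_root (S.charlie_povm _) (hJc _) (hJc4 _)
  · exact isKrausMat_of_fourth_root (S.charlie_povm _) (hJc _) (hJc4 _)
  set θ' := flipAll θ with hθ'
  -- The round at the complement is read backwards, so that Alice's pair at site `i` is the same as
  -- in the round at `θ`, as `deviation_le_of_rounds` requires.
  have hr' : ∀ i, IsRound (aliceObs B C R i (θ i)) (aliceObs B C R i (θ i + 1))
      (b (flipAt θ' i) i) (b θ' i) (c (flipAt θ' i) i) (c θ' i) := fun i => by
    have h := (hround θ' i).swap
    rwa [show θ' i + 1 = θ i from fin_two_add_one_add_one _] at h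
  have hD' : ∀ i, D θ' i = roundDefect (aliceObs B C R i (θ i)) (aliceObs B C R i (θ i + 1))
      (b (flipAt θ' i) i) (b θ' i) (c (flipAt θ' i) i) (c θ' i) v := fun i => by
    simp only [hD]
    rw [roundDefect_swap, show θ' i + 1 = θ i from fin_two_add_one_add_one _]
    rfl
  have hfin := sum_norm_sub_ite_sq_le
    (P := fun x y => aliceOp _ B C R (labelProj (labelOf θ x y)))
    (α := fun i => aliceObs B C R i (θ i)) (α' := fun i => aliceObs B C R i (θ i + 1))
    (J := fun x => fB (Jb θ x)) (J' := fun x => fB (Jb θ' x))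
    (G := fun x => fC (Jc θ x)) (G' := fun x => fC (Jc θ' x))
    (fun x => bobOp_isSymmetric (hJb _ x)) (fun x => charlieOp_isSymmetric (hJc _ x))
    (fun x => bobOp_isSymmetric (hJb _ x)) (fun x => charlieOp_isSymmetric (hJc _ x))
    (hKb θ) (hKc θ) (hKb θ') (hKc θ') (fun i => aliceObs_pair i _)
    (fun _ _ => (hAB _ _).symm) (fun _ _ => (hAB _ _).symm) (fun _ _ => (hAC _ _).symm)
    (fun _ _ => (hAC _ _).symm) (fun _ _ => (hAB _ _).symm) (fun _ _ => (hAB _ _).symm)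
    (fun _ _ => (hAC _ _).symm) (fun _ _ => (hAC _ _).symm)
    (fun _ _ => hBC _ _) (fun _ _ => hBC _ _) (fun _ _ => hBC _ _) (fun _ _ => hBC _ _)
    (fun _ _ _ => (hAB _ _).symm) (fun _ _ _ => (hAC _ _).symm)
    (fun x y u => by
      refine (norm_sub_labelProj_sq_le (labelOf θ x y) u).trans (le_of_eq ?_)
      refine Finset.sum_congr rfl fun i _ => ?_
      simp only [labelOf]
      generalize θ i = s
      fin_cases s
      · simp
      · simp [add_comm])
    v (μ := fun i => D θ i) (μ' := fun i => D θ' i) (δ := fun i => 30 * (D θ i + D θ' i))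
    (fun i => by rw [hb, hc]; exact (hround θ i).agreementDefect_le v)
    (fun i => by rw [hb, hc, hD']; exact (hr' i).agreementDefect_le' v)
    (fun i => by
      rw [hb, hc, hD']
      exact deviation_le_of_rounds (hround θ i) (hr' i) (hBC _ _) (hBC _ _) v)
  have hop : ∀ x x' y y', leftAction _ R ((1 : Matrix (Fin n → Fin 2) (Fin n → Fin 2) ℂ)
        ⊗ₖ ((Jb θ' x' * Jb θ' x' * (Jb θ x * Jb θ x))
          ⊗ₖ (Jc θ y * Jc θ y * (Jc θ' y' * Jc θ' y')))) v
      = (fB (Jb θ' x') * fB (Jb θ' x')) ((fB (Jb θ x) * fB (Jb θ x))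
        ((fC (Jc θ y) * fC (Jc θ y)) ((fC (Jc θ' y') * fC (Jc θ' y')) v))) :=
    fun x x' y y' => by
      rw [← bobOp_mul_charlieOp]
      simp only [map_mul]
      rfl
  simp only [hop]
  refine hfin.trans ?_
  have hsum : ∑ i, D θ i + ∑ i, D θ' i ≤ 16 * n * ε := by
    rw [← Finset.sum_add_distrib]
    simp only [hDw, ← mul_add, ← Finset.mul_sum]
    linarith
  have hn' : (1 : ℝ) ≤ n := by exact_mod_cast hn
  have h1 : (100 * n * √ε) ^ 2 = 10000 * n ^ 2 * ε := by
    rw [mul_pow, Real.sq_sqrt hε]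
    ring
  rw [h1, ← Finset.mul_sum, Finset.sum_add_distrib]
  -- Here `538 = 28 + 17 * 30`, and `16 * (8 * n + 538) * n ≤ 10000 * n ^ 2` for `n ≥ 1`.
  have h2 : (8 * n + 538) * (∑ i, D θ i + ∑ i, D θ' i) ≤ (8 * n + 538) * (16 * n * ε) :=
    mul_le_mul_of_nonneg_left hsum (by positivity)
  have h3 : 0 ≤ (n - 1 : ℝ) * (n * ε) :=
    mul_nonneg (by linarith) (mul_nonneg (by linarith) hε)
  have h4 : (0 : ℝ) ≤ n * n * ε := by positivity
  nlinarith

end Strategies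

/-! ### Trace distance of purified states and orthogonality of supports. -/

section TraceNorm

theorem partialTraceRight_ketbra {D R : Type*} [Fintype R] (φ : D × R → ℂ) :
    partialTraceRight (ketbra φ)
      = (Matrix.of fun d r => φ (d, r)) * (Matrix.of fun d r => φ (d, r))ᴴ := by
  ext d d'
  simp [partialTraceRight, ketbra, Matrix.vecMulVec_apply, Matrix.mul_apply]

variable {D : Type*} [Fintype D] [DecidableEq D]

/-- A Hermitian operator becomes its absolute value on multiplication by a Hermitian unitary. -/
theorem Matrix.IsHermitian.exists_sign {L : Matrix D D ℂ} (hL : L.IsHermitian) :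
    ∃ T : Matrix D D ℂ, T.IsHermitian ∧ T * T = 1 ∧ cfc Real.sqrt (Lᴴ * L) = T * L := by
  have hsa : IsSelfAdjoint L := hL
  have hfin : (spectrum ℝ L).Finite := Matrix.finite_real_spectrum
  -- The sign is taken to be `1` at zero so that it squares to one everywhere; continuity on the
  -- finite spectrum is automatic.
  set g : ℝ → ℝ := fun x => if 0 ≤ x then 1 else -1
  have hg : ContinuousOn g (spectrum ℝ L) := hfin.continuousOn g
  refine ⟨cfc g L, cfc_predicate g L, ?_, ?_⟩
  · rw [← cfc_mul g g L hg hg, ← cfc_one ℝ L]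
    refine cfc_congr fun x _ => ?_
    simp only [g]
    split_ifs <;> norm_num
  · have h1 : Lᴴ * L = cfc (fun x : ℝ => x ^ 2) L := by
      rw [cfc_pow_id L 2, hL.eq, sq]
    rw [h1, ← cfc_comp' Real.sqrt (fun x : ℝ => x ^ 2) L]
    nth_rewrite 3 [← cfc_id ℝ L]
    rw [← cfc_mul g id L hg]
    refine cfc_congr fun x _ => ?_
    simp only [g, Real.sqrt_sq_eq_abs, id]
    split_ifs with h
    · rw [abs_of_nonneg h, one_mul]
    · rw [abs_of_neg (not_le.1 h), neg_one_mul]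

/-- With `T` the sign of the difference, the trace norm is half a difference of two quadratic forms
of the isometry `T`, each term of whose telescoping is at most the distance of the unit vectors. The
register `R` is traced out for free, because `T` acts on `D` only. -/
theorem traceNorm_sub_le {R : Type*} [Fintype R] {M N : Matrix D R ℂ} (hM : ‖coeffVec M‖ = 1)
    (hN : ‖coeffVec N‖ = 1) :
    traceNorm (M * Mᴴ - N * Nᴴ) ≤ ‖coeffVec M - coeffVec N‖ := by
  have hL : (M * Mᴴ - N * Nᴴ).IsHermitian :=
    (Matrix.isHermitian_mul_conjTranspose_self M).sub (Matrix.isHermitian_mul_conjTranspose_self N)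
  obtain ⟨T, hT, hTT, hTL⟩ := hL.exists_sign
  set f := leftAction D R T with hf
  have hfs : f.IsSymmetric := leftAction_isSymmetric hT
  have hff : f * f = 1 := by rw [hf, ← map_mul, hTT, map_one]
  rw [traceNorm, hTL, mul_sub, Matrix.trace_sub, Complex.sub_re, ← inner_leftAction_coeffVec,
    ← inner_leftAction_coeffVec]
  set u := coeffVec M
  set w := coeffVec N
  have hnorm : ∀ x, ‖f x‖ = ‖x‖ := fun x =>
    (sq_eq_sq₀ (norm_nonneg _) (norm_nonneg _)).1 (norm_sq_of_involution hfs hff x)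
  have h1 : ⟪u, f u⟫_ℝ - ⟪w, f w⟫_ℝ = ⟪u - w, f u⟫_ℝ + ⟪w, f (u - w)⟫_ℝ := by
    rw [map_sub, inner_sub_left, inner_sub_right]
    ring
  have h2 := real_inner_le_norm (u - w) (f u)
  have h3 := real_inner_le_norm w (f (u - w))
  rw [hnorm, hM] at h2
  rw [hnorm, hN] at h3
  have h4 : ⟪u, f u⟫_ℝ - ⟪w, f w⟫_ℝ ≤ 2 * ‖u - w‖ := by rw [h1]; linarith
  change 1 / 2 * (⟪u, f u⟫_ℝ - ⟪w, f w⟫_ℝ) ≤ _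
  linarith

theorem traceNorm_sub_partialTraceRight_le {R : Type*} [Fintype R] {M : Matrix D R ℂ}
    {φ : D × R → ℂ} (hM : ‖coeffVec M‖ = 1) (hφ : ‖WithLp.toLp 2 φ‖ = 1) :
    traceNorm (M * Mᴴ - partialTraceRight (ketbra φ)) ≤ ‖coeffVec M - WithLp.toLp 2 φ‖ := by
  rw [partialTraceRight_ketbra]
  exact traceNorm_sub_le hM hφ

/-- The ranges live on complementary sets of basis vectors. -/
theorem operatorSupport_isOrtho {ρ σ : Matrix D D ℂ} (s : Set D)
    (hρ : ∀ p q, p ∉ s → ρ p q = 0) (hσ : ∀ p q, p ∈ s → σ p q = 0) :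
    operatorSupport ρ ⟂ operatorSupport σ := by
  rw [Submodule.isOrtho_iff_inner_eq]
  rintro _ ⟨x, rfl⟩ _ ⟨y, rfl⟩
  rw [PiLp.inner_apply]
  refine Finset.sum_eq_zero fun p _ => ?_
  by_cases hp : p ∈ s
  · have h : (Matrix.toEuclideanLin σ y) p = 0 := by
      simp [Matrix.toEuclideanLin, Matrix.toLpLin_apply, Matrix.mulVec, dotProduct, hσ p _ hp]
    rw [h, inner_zero_right]
  · have h : (Matrix.toEuclideanLin ρ x) p = 0 := by
      simp [Matrix.toEuclideanLin, Matrix.toLpLin_apply, Matrix.mulVec, dotProduct, hρ p _ hp]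
    rw [h, inner_zero_left]

end TraceNorm

/-! ### Recording outcomes in label registers. -/

section Labels

variable {T A B C R : Type*}

/-- Vectors in which both registers carry the label of the vector have orthogonal supports. -/
theorem hasOrthogonalSupports_of_labels [Fintype T] [DecidableEq T] [Fintype B] [DecidableEq B]
    [Fintype C] [DecidableEq C] [Fintype R] {ψ : T → (B × T) × (C × T) × R → ℂ}
    (h : ∀ t p, ¬(p.1.2 = t ∧ p.2.1.2 = t) → ψ t p = 0) : HasOrthogonalSupports ψ := by
  intro t t' ht
  refine ⟨operatorSupport_isOrtho {p | p.2 = t} (fun p q hp => ?_) (fun p q hp => ?_),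
    operatorSupport_isOrtho {p | p.2 = t} (fun p q hp => ?_) (fun p q hp => ?_)⟩
  · simp only [partialTraceRight, ketbra, Matrix.vecMulVec_apply, Matrix.of_apply]
    refine Finset.sum_eq_zero fun k _ => ?_
    rw [h t (p, k) fun h' => hp h'.1, zero_mul]
  · simp only [partialTraceRight, ketbra, Matrix.vecMulVec_apply, Matrix.of_apply]
    refine Finset.sum_eq_zero fun k _ => ?_
    rw [h t' (p, k) fun h' => ht (hp.symm.trans h'.1), zero_mul]
  · simp only [partialTraceRight, partialTraceLeft, ketbra, Matrix.vecMulVec_apply,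
      Matrix.of_apply]
    refine Finset.sum_eq_zero fun k _ => Finset.sum_eq_zero fun l _ => ?_
    rw [h t (l, p, k) fun h' => hp h'.2, zero_mul]
  · simp only [partialTraceRight, partialTraceLeft, ketbra, Matrix.vecMulVec_apply,
      Matrix.of_apply]
    refine Finset.sum_eq_zero fun k _ => Finset.sum_eq_zero fun l _ => ?_
    rw [h t' (l, p, k) fun h' => ht (hp.symm.trans h'.2), zero_mul]

/-- The vector with the given components for the labels of two registers. -/
def attachLabels (f : T → T → EuclideanSpace ℂ ((A × B × C) × R)) :
    EuclideanSpace ℂ ((A × (B × T) × (C × T)) × R) :=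
  WithLp.toLp 2 fun p => f p.1.2.1.2 p.1.2.2.2 ((p.1.1, p.1.2.1.1, p.1.2.2.1), p.2)

variable [Fintype A] [Fintype B] [Fintype C] [Fintype R]

theorem norm_sq_attachLabels [Fintype T] (f : T → T → EuclideanSpace ℂ ((A × B × C) × R)) :
    ‖attachLabels f‖ ^ 2 = ∑ t, ∑ t', ‖f t t'‖ ^ 2 := by
  let e : (A × (B × T) × (C × T)) × R ≃ (T × T) × ((A × B × C) × R) :=
    { toFun := fun p => ((p.1.2.1.2, p.1.2.2.2), ((p.1.1, p.1.2.1.1, p.1.2.2.1), p.2))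
      invFun := fun q => ((q.2.1.1, (q.2.1.2.1, q.1.1), (q.2.1.2.2, q.1.2)), q.2.2)
      left_inv := fun _ => rfl
      right_inv := fun _ => rfl }
  rw [EuclideanSpace.norm_sq_eq, ← Fintype.sum_prod_type']
  simp only [EuclideanSpace.norm_sq_eq]
  rw [← Fintype.sum_prod_type']
  exact Fintype.sum_equiv e _ _ fun _ => rfl

/-- The operator that measures with the Kraus operators `N` and records the outcome. -/
def recordOp (N : T → Matrix B B ℂ) : Matrix (B × T) B ℂ :=
  Matrix.of fun p b => N p.2 p.1 b

variable [DecidableEq A] [DecidableEq B] [DecidableEq C]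

theorem recordOp_isIsometry {T B : Type*} [Fintype T] [Fintype B] [DecidableEq B]
    {N : T → Matrix B B ℂ} (hN : ∑ t, (N t)ᴴ * N t = 1) :
    IsIsometry (recordOp N) := by
  rw [IsIsometry, ← hN]
  ext b b'
  simp only [recordOp, Matrix.mul_apply, Matrix.conjTranspose_apply, Matrix.of_apply,
    Fintype.sum_prod_type, Matrix.sum_apply]
  exact Finset.sum_comm

theorem coeffVec_recordOp_mul (N : T → Matrix B B ℂ) (P : T → Matrix C C ℂ)
    (M : Matrix (A × B × C) R ℂ) :
    coeffVec (((1 : Matrix A A ℂ) ⊗ₖ (recordOp N ⊗ₖ recordOp P)) * M)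
      = attachLabels fun t t' =>
        leftAction (A × B × C) R ((1 : Matrix A A ℂ) ⊗ₖ (N t ⊗ₖ P t')) (coeffVec M) := by
  ext p
  rfl

theorem aliceOp_apply (M : Matrix A A ℂ) (v : EuclideanSpace ℂ ((A × B × C) × R))
    (a : A) (b : B) (c : C) (r : R) :
    aliceOp A B C R M v ((a, b, c), r) = ∑ a', M a a' * v ((a', b, c), r) := by
  change leftAction (A × B × C) R (M ⊗ₖ 1) v ((a, b, c), r) = _
  rw [leftAction_apply, Fintype.sum_prod_type]
  refine Finset.sum_congr rfl fun a' _ => ?_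
  rw [Fintype.sum_eq_single (b, c) fun q hq => by
    simp [Matrix.kroneckerMap_apply, Matrix.one_apply_ne hq.symm]]
  simp [Matrix.kroneckerMap_apply]

end Labels

/-! ### Labelled combinations of Wiesner-Breidbart states and their normalisation. -/

section Combinations

variable {n : ℕ} {B C R : Type*}

theorem labelProj_apply (t : Fin n → Fin 2 → Fin 2) (a a' : Fin n → Fin 2) :
    labelProj t a a' = tensorVec (fun i => wiesnerBreidbart (t i)) a
      * star (tensorVec (fun i => wiesnerBreidbart (t i)) a') := by
  simp [labelProj, tensorOp, tensorVec, ketbra, Matrix.vecMulVec_apply, Finset.prod_mul_distrib]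

theorem exists_wiesnerBreidbart_ne_zero (s : Fin 2 → Fin 2) : ∃ y, wiesnerBreidbart s y ≠ 0 := by
  by_contra! h
  have h1 : ketbra (wiesnerBreidbart s) 0 0 + ketbra (wiesnerBreidbart s) 1 1 = 0 := by
    simp [ketbra, Matrix.vecMulVec_apply, h]
  rw [ketbra_wiesnerBreidbart] at h1
  simp [pauliX, pauliZ] at h1
  ring_nf at h1
  norm_num at h1

theorem wiesnerBreidbartCombination_smul (z : ℂ)
    (ψ : (Fin n → Fin 2 → Fin 2) → B × C × R → ℂ) :
    wiesnerBreidbartCombination (z • ψ) = z • wiesnerBreidbartCombination ψ := by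
  funext p
  simp [wiesnerBreidbartCombination, Finset.mul_sum, mul_left_comm]

/-- The combination of Wiesner-Breidbart states as an element of a Hilbert space. -/
def combinationVec (ψ : (Fin n → Fin 2 → Fin 2) → B × C × R → ℂ) :
    EuclideanSpace ℂ (((Fin n → Fin 2) × B × C) × R) :=
  WithLp.toLp 2 (wiesnerBreidbartCombination ψ)

/-- Both registers carry the label of the vector. -/
def IsLabelled {T : Type*} (ψ : T → (B × T) × (C × T) × R → ℂ) : Prop :=
  ∀ t p, ¬(p.1.2 = t ∧ p.2.1.2 = t) → ψ t p = 0

theorem exists_isLabelled_combinationVec_ne_zero [Nonempty B] [Nonempty C] [Nonempty R] :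
    ∃ ψ : (Fin n → Fin 2 → Fin 2) →
      (B × (Fin n → Fin 2 → Fin 2)) × (C × (Fin n → Fin 2 → Fin 2)) × R → ℂ,
      IsLabelled ψ ∧ combinationVec ψ ≠ 0 := by
  classical
  obtain ⟨b⟩ := ‹Nonempty B›
  obtain ⟨c⟩ := ‹Nonempty C›
  obtain ⟨r⟩ := ‹Nonempty R›
  choose y hy using exists_wiesnerBreidbart_ne_zero
  refine ⟨fun t p => if p.1.2 = t ∧ p.2.1.2 = t then 1 else 0,
    fun t p hp => if_neg hp, fun h => ?_⟩
  have h1 := congrArg (fun v => v (((fun _ => y 0), (b, 0), (c, 0)), r)) h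
  simp only [combinationVec, wiesnerBreidbartCombination, PiLp.zero_apply, and_self, mul_ite,
    mul_one, mul_zero, Finset.sum_ite_eq, Finset.mem_univ, if_true, tensorVec] at h1
  exact Finset.prod_ne_zero_iff.2 (fun i _ => hy 0) h1

variable [Fintype B] [Fintype C] [Fintype R]

theorem norm_sq_combinationVec (ψ : (Fin n → Fin 2 → Fin 2) → B × C × R → ℂ) :
    ‖combinationVec ψ‖ ^ 2 = ∑ p, ‖wiesnerBreidbartCombination ψ p‖ ^ 2 :=
  EuclideanSpace.norm_sq_eq _

theorem exists_normalized {ψ : (Fin n → Fin 2 → Fin 2) →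
      (B × (Fin n → Fin 2 → Fin 2)) × (C × (Fin n → Fin 2 → Fin 2)) × R → ℂ}
    (hψ : IsLabelled ψ) (h0 : combinationVec ψ ≠ 0) :
    ∃ ψ', IsLabelled ψ' ∧ ‖combinationVec ψ'‖ = 1 ∧
      ‖combinationVec ψ - combinationVec ψ'‖ = |‖combinationVec ψ‖ - 1| := by
  have hpos : 0 < ‖combinationVec ψ‖ := norm_pos_iff.2 h0
  have h1 : combinationVec (((‖combinationVec ψ‖⁻¹ : ℝ) : ℂ) • ψ)
      = (‖combinationVec ψ‖⁻¹ : ℝ) • combinationVec ψ := by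
    rw [combinationVec, wiesnerBreidbartCombination_smul]
    ext p
    simp [combinationVec]
  refine ⟨((‖combinationVec ψ‖⁻¹ : ℝ) : ℂ) • ψ, fun t p hp => ?_, ?_, ?_⟩
  · simp [hψ t p hp]
  · rw [h1, norm_smul, norm_inv, norm_norm, inv_mul_cancel₀ hpos.ne']
  · rw [h1]
    nth_rewrite 1 [← one_smul ℝ (combinationVec ψ)]
    rw [← sub_smul, norm_smul, Real.norm_eq_abs]
    nth_rewrite 2 [← abs_of_pos hpos]
    rw [← abs_mul, sub_mul, one_mul, inv_mul_cancel₀ hpos.ne']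

/-- Normalising moves the vector by `|‖·‖ - 1|`, at most `η` by the reverse triangle inequality,
whence the factor two. If the combination vanishes then `η ≥ 1`, and any labelled unit combination
is within distance two. -/
theorem exists_close_combinationVec [Nonempty B] [Nonempty C] [Nonempty R]
    {ψ : (Fin n → Fin 2 → Fin 2) →
      (B × (Fin n → Fin 2 → Fin 2)) × (C × (Fin n → Fin 2 → Fin 2)) × R → ℂ}
    (hψ : IsLabelled ψ) {u} (hu : ‖u‖ = 1) {η : ℝ} (h : ‖u - combinationVec ψ‖ ≤ η) :
    ∃ ψ', IsLabelled ψ' ∧ ‖combinationVec ψ'‖ = 1 ∧ ‖u - combinationVec ψ'‖ ≤ 2 * η := by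
  by_cases h0 : combinationVec ψ = 0
  · obtain ⟨ψ₁, h₁, h₁0⟩ := exists_isLabelled_combinationVec_ne_zero (n := n) (B := B) (C := C)
      (R := R)
    obtain ⟨ψ', h', hn, -⟩ := exists_normalized h₁ h₁0
    refine ⟨ψ', h', hn, (norm_sub_le _ _).trans ?_⟩
    rw [h0, sub_zero, hu] at h
    rw [hu, hn]
    linarith
  · obtain ⟨ψ', h', hn, hd⟩ := exists_normalized hψ h0
    refine ⟨ψ', h', hn, (norm_sub_le_norm_sub_add_norm_sub _ (combinationVec ψ) _).trans ?_⟩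
    have h1 := abs_norm_sub_norm_le (combinationVec ψ) u
    rw [hu, norm_sub_rev] at h1
    linarith

variable [DecidableEq B] [DecidableEq C]

/-- The components of the projection of a vector onto the Wiesner-Breidbart states. -/
def labelComponent (f : (Fin n → Fin 2 → Fin 2) →
      EuclideanSpace ℂ (((Fin n → Fin 2) × B × C) × R)) (t : Fin n → Fin 2 → Fin 2)
    (p : (B × (Fin n → Fin 2 → Fin 2)) × (C × (Fin n → Fin 2 → Fin 2)) × R) : ℂ :=
  if p.1.2 = t ∧ p.2.1.2 = t then
    ∑ a, star (tensorVec (fun i => wiesnerBreidbart (t i)) a)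
      * f t ((a, p.1.1, p.2.1.1), p.2.2) else 0

/-- Contracting Alice's register with a Wiesner-Breidbart state and tensoring that state back is the
projection; this exhibits the projected vector as a combination of the required form. -/
theorem combinationVec_labelComponent (f : (Fin n → Fin 2 → Fin 2) →
      EuclideanSpace ℂ (((Fin n → Fin 2) × B × C) × R)) :
    combinationVec (labelComponent f) = attachLabels fun t t' =>
      if t = t' then aliceOp _ B C R (labelProj t) (f t) else 0 := by
  ext ⟨⟨a, ⟨b, t⟩, ⟨c, t'⟩⟩, r⟩
  simp only [combinationVec, wiesnerBreidbartCombination, labelComponent, attachLabels]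
  rw [Fintype.sum_eq_single t fun s hs => by rw [if_neg fun h => hs h.1.symm, mul_zero]]
  by_cases h : t = t'
  · subst h
    rw [if_pos ⟨rfl, rfl⟩, if_pos rfl, aliceOp_apply, Finset.mul_sum]
    exact Finset.sum_congr rfl fun a' _ => by rw [labelProj_apply, mul_assoc]
  · rw [if_neg fun h' => h h'.2.symm, if_neg h, mul_zero]
    rfl

end Combinations

/-! ### Assembly of the isometries and the final bound. -/

section Main

theorem isKrausMat_sum_mul {X H T : Type*} [Fintype X] [Fintype H] [DecidableEq H] [Fintype T]
    (e : T ≃ X × X) {K L : X → Matrix H H ℂ} (hK : IsKrausMat K) (hL : IsKrausMat L) :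
    ∑ t, (L (e t).2 * K (e t).1)ᴴ * (L (e t).2 * K (e t).1) = 1 := by
  rw [Equiv.sum_comp e fun p => (L p.2 * K p.1)ᴴ * (L p.2 * K p.1), Fintype.sum_prod_type, ← hK.2]
  refine Finset.sum_congr rfl fun x _ => ?_
  have h : ∀ y, (L y * K x)ᴴ * (L y * K x) = K x * (L y * L y) * K x := fun y => by
    rw [Matrix.conjTranspose_mul, (hK.1 x).eq, (hL.1 y).eq]
    simp only [mul_assoc]
  simp only [h]
  rw [← Finset.sum_mul, ← Finset.mul_sum, hL.2, mul_one]

theorem kronecker_isIsometry {A B B' C C' : Type*} [Fintype A] [DecidableEq A]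
    [DecidableEq B] [Fintype B'] [DecidableEq C] [Fintype C']
    {V : Matrix B' B ℂ} {W : Matrix C' C ℂ} (hV : IsIsometry V) (hW : IsIsometry W) :
    IsIsometry ((1 : Matrix A A ℂ) ⊗ₖ (V ⊗ₖ W)) := by
  rw [IsIsometry, Matrix.conjTranspose_kronecker, Matrix.conjTranspose_kronecker,
    ← Matrix.mul_kronecker_mul, ← Matrix.mul_kronecker_mul, hV, hW, Matrix.conjTranspose_one,
    one_mul, Matrix.one_kronecker_one, Matrix.one_kronecker_one]

end Main
end

theorem mainTheorem9 :
    ∃ K : ℝ, 0 ≤ K ∧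
      ∀ (n : ℕ), 1 ≤ n →
      ∀ (B C : Type u) [Fintype B] [DecidableEq B] [Fintype C] [DecidableEq C]
        (S : MoEStrategy (Fin n → Fin 2) (Fin n → Fin 2) (Fin n → Fin 2) B C)
        (ε : ℝ), 0 ≤ ε →
        (∀ i : Fin n, Real.cos (Real.pi / 8) ^ 2 - ε ≤ tfkwGame.coordWinProb S i) →
        ∃ (B' C' R : Type u) (_ : Fintype B') (_ : DecidableEq B') (_ : Fintype C')
          (_ : DecidableEq C') (_ : Fintype R)
          (V : Matrix B' B ℂ) (W : Matrix C' C ℂ)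
          (ψ : (Fin n → Fin 2 → Fin 2) → B' × C' × R → ℂ),
          IsIsometry V ∧ IsIsometry W ∧
          HasOrthogonalSupports ψ ∧
          ∑ p, ‖wiesnerBreidbartCombination ψ p‖ ^ 2 = 1 ∧
          traceNorm
              (((1 : Matrix (Fin n → Fin 2) (Fin n → Fin 2) ℂ) ⊗ₖ (V ⊗ₖ W)) * S.state *
                  ((1 : Matrix (Fin n → Fin 2) (Fin n → Fin 2) ℂ) ⊗ₖ (V ⊗ₖ W))ᴴ
                - partialTraceRight (ketbra (wiesnerBreidbartCombination ψ)))
            ≤ K * (n : ℝ) ^ 3 * Real.sqrt ε := by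
  refine ⟨200, by norm_num, fun n hn B C _ _ _ _ S ε hε hS => ?_⟩
  obtain ⟨M, hM⟩ : ∃ M : Matrix ((Fin n → Fin 2) × B × C) ((Fin n → Fin 2) × B × C) ℂ,
      S.state = M * Mᴴ := by
    open scoped MatrixOrder in
    exact CStarAlgebra.nonneg_iff_eq_mul_star_self.mp S.state_density.1.nonneg
  obtain ⟨θ, K, K', L, L', hK, hK', hL, hL', hsum⟩ := exists_isKrausMat hn S hM hε hS
  -- A density operator has trace one, so its register is nonempty.
  obtain ⟨⟨a₀, b₀, c₀⟩⟩ : Nonempty ((Fin n → Fin 2) × B × C) := by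
    by_contra h
    rw [not_nonempty_iff] at h
    have h1 := S.state_density.2
    simp [Matrix.trace] at h1
  have : Nonempty B := ⟨b₀⟩
  have : Nonempty C := ⟨c₀⟩
  set e := labelEquiv θ with he
  set N : (Fin n → Fin 2 → Fin 2) → Matrix B B ℂ := fun t => K' (e t).2 * K (e t).1 with hN
  set P : (Fin n → Fin 2 → Fin 2) → Matrix C C ℂ := fun t => L (e t).1 * L' (e t).2 with hP
  have hV : IsIsometry (recordOp N) := recordOp_isIsometry (isKrausMat_sum_mul e hK hK')
  have hW : IsIsometry (recordOp P) :=
    -- The components of the label are swapped because Charlie measures the complement first.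
    recordOp_isIsometry (isKrausMat_sum_mul (e.trans (Equiv.prodComm _ _)) hL' hL)
  set G := (1 : Matrix (Fin n → Fin 2) (Fin n → Fin 2) ℂ) ⊗ₖ (recordOp N ⊗ₖ recordOp P) with hG
  have hGi : IsIsometry G := kronecker_isIsometry hV hW
  set F := fun t t' => leftAction ((Fin n → Fin 2) × B × C) ((Fin n → Fin 2) × B × C)
    ((1 : Matrix (Fin n → Fin 2) (Fin n → Fin 2) ℂ) ⊗ₖ (N t ⊗ₖ P t')) (coeffVec M) with hF
  have hu : coeffVec (G * M) = attachLabels F := coeffVec_recordOp_mul N P M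
  have hGρ : G * S.state * Gᴴ = (G * M) * (G * M)ᴴ := by
    rw [hM, Matrix.conjTranspose_mul]
    simp only [Matrix.mul_assoc]
  have hu1 : ‖coeffVec (G * M)‖ = 1 := by
    refine norm_coeffVec_eq_one hGρ ?_
    rw [Matrix.trace_mul_comm, ← Matrix.mul_assoc, hGi, Matrix.one_mul, S.state_density.2]
  -- The labels of both parties are re-indexed as pairs of outcomes by `e`, and equality of labels
  -- becomes agreement of both outcomes.
  have hclose : ‖coeffVec (G * M) - combinationVec (labelComponent fun t => F t t)‖
      ≤ 100 * n * √ε := by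
    refine abs_le_of_sq_le_sq' ?_ (by positivity) |>.2
    have h1 : coeffVec (G * M) - combinationVec (labelComponent fun t => F t t)
        = attachLabels fun t t' => F t t' - if t = t' then
          aliceOp _ B C _ (labelProj t) (F t t') else 0 := by
      rw [hu, combinationVec_labelComponent]
      ext p
      simp only [attachLabels, PiLp.sub_apply]
      split_ifs with h
      · rw [h]
      · rfl
    rw [h1, norm_sq_attachLabels]
    refine le_trans (le_of_eq ?_) hsum
    rw [← Equiv.sum_comp e.symm, Fintype.sum_prod_type]
    refine Finset.sum_congr rfl fun x _ => Finset.sum_congr rfl fun x' _ => ?_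
    rw [← Equiv.sum_comp e.symm, Fintype.sum_prod_type]
    refine Finset.sum_congr rfl fun y _ => Finset.sum_congr rfl fun y' _ => ?_
    simp only [hF, hN, hP, Equiv.apply_symm_apply, e.symm.injective.eq_iff, Prod.mk.injEq]
    rfl
  obtain ⟨ψ, hψ, hψ1, hψu⟩ := exists_close_combinationVec (fun t p hp => if_neg hp) hu1 hclose
  let dB : DecidableEq (B × (Fin n → Fin 2 → Fin 2)) := inferInstance
  let dC : DecidableEq (C × (Fin n → Fin 2 → Fin 2)) := inferInstance
  have hbound : traceNorm (G * S.state * Gᴴ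
      - partialTraceRight (ketbra (wiesnerBreidbartCombination ψ))) ≤ 200 * n ^ 3 * √ε := by
    rw [hGρ]
    refine (traceNorm_sub_partialTraceRight_le hu1 hψ1).trans (hψu.trans ?_)
    have hn' : (1 : ℝ) ≤ n := by exact_mod_cast hn
    -- The estimate obtained is `200 * n * √ε`, linear in `n`; the cubic bound is a weakening.
    have h2 : (n : ℝ) ≤ n ^ 3 := le_self_pow₀ hn' (by norm_num)
    nlinarith [mul_le_mul_of_nonneg_right h2 (Real.sqrt_nonneg ε)]
  exact ⟨B × (Fin n → Fin 2 → Fin 2), C × (Fin n → Fin 2 → Fin 2), (Fin n → Fin 2) × B × C,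
    inferInstance, dB, inferInstance, dC, inferInstance,
    recordOp N, recordOp P, ψ, hV, hW, hasOrthogonalSupports_of_labels hψ,
    by rw [← norm_sq_combinationVec, hψ1, one_pow], hbound⟩
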